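/- Let $n\ge 2$ with $n-1\equiv 0\pmod 8$. Let $E$ be a Euclidean space of dimension $n-1$ with inner product $(\cdot,\cdot)$, and let $\mathfrak m=E\oplus\mathbb R p\oplus\mathbb R q$ be Minkowski space with scalar product $\langle\cdot,\cdot\rangle$ given by $\langle e,f\rangle=-(e,f)$ for $e,f\in E$, $p,q$ isotropic and orthogonal to $E$, $\langle p,q\rangle=1$. Clifford algebras are taken with the convention $v^2=-\langle v,v\rangle$. Write $e^\flat=\langle e,\cdot\rangle\in E^*$. Let $b$ be a non-degenerate symmetric bilinear form on $E$, let $B\in\mathrm{End}(E)$ be defined by $b(e,f)=-\langle Be,f\rangle$, and let $\mathfrak{heis}_b=E^*+E+\mathbb R p$ be the Lie algebra whose only non-trivial brackets are $[e^\flat,f]=b(e,f)\,p=-[f,e^\flat]$. Let $S_0$ be an irreducible real $\mathrm{Cl}(E)$-module and let $S=S_0\oplus S_0$ (columns) be the irreducible $\mathrm{Cl}(\mathfrak m)$-module on which $e\in E$, $p$, $q$ act by $$\begin{pmatrix}-e&0\\0&e\end{pmatrix},\qquad \begin{pmatrix}0&2\sqrt2\\0&0\end{pmatrix},\qquad \begin{pmatrix}0&0\\-\tfrac1{\sqrt2}&0\end{pmatrix}.$$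 A Lie algebra representation $\rho:\mathfrak{heis}_b\to\mathfrak{gl}_{\mathbb R}(S)$ is called spin if, for all $e\in E$, $\rho(e^\flat)$ is the action on $S$ of $\tfrac14(p\cdot Be-Be\cdot p)\in\mathrm{Cl}(\mathfrak m)$; it has non-zero charge if $\rho(p)\neq0$. The Schur algebra is the algebra of real endomorphisms of $S_0$ that commute with all $\tfrac14(vw-wv)$, $v,w\in E$ (the action of $\mathfrak{so}(E)$). A para-complex structure is an endomorphism with square $\mathrm{Id}$ whose $\pm1$-eigenspaces have equal dimension. For linear maps $\rho_{11},\rho_{22},\rho_{12}:E\to\mathrm{End}_{\mathbb R}(S_0)$, call $\rho_{12}$ $(\rho_{11},\rho_{22})$-suitable if $(e,f)\mapsto\rho_{11}(e)\rho_{12}(f)-\rho_{12}(f)\rho_{22}(e)$ is symmetric. Then the volume element $e_1\cdots e_{n-1}$ of any orthonormal basis of $E$ acts on $S_0$ as a para-complex structure belonging to the Schur algebra. Moreover, let $\mathcal E$ be any para-complex structure in the Schur algebra. For every spin representation $\rho$ of $\mathfrak{heis}_b$ of non-zero charge there are a sign $\pm$, a real number $h_1\ne0$, a linear form $h_3\in\mathrm{Hom}_{\mathbb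 R}(E,\mathbb R)$ and a linear map $\rho_{12}:E\to\mathrm{End}_{\mathbb R}(S_0)$ such that $$\rho(p)=\sqrt2\begin{pmatrix}0&h_1(\mathrm{Id}\pm \mathcal E)\\0&0\end{pmatrix},\qquad \rho(e)=\begin{pmatrix}\rho_{11}(e)&\rho_{12}(e)\\0&\rho_{22}(e)\end{pmatrix}\quad(e\in E),$$ where $$\rho_{11}(e)=\tfrac12\bigl(h_3(e)\mathrm{Id}-h_1e\pm h_1e\,\mathcal E\bigr),\qquad \rho_{22}(e)=\tfrac12\bigl(h_3(e)\mathrm{Id}+h_1e\pm h_1e\,\mathcal E\bigr)$$ (the same sign throughout), and $\rho_{12}$ is $(\rho_{11},\rho_{22})$-suitable. Conversely, for every sign $\pm$, every real $h_1\neq0$, every linear form $h_3$ and every $(\rho_{11},\rho_{22})$-suitable map $\rho_{12}$, these formulas define exactly one spin representation of $\mathfrak{heis}_b$, and it has non-zero charge. -/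

import Mathlib

-- the commutator bracket on associative rings, here on `𝔤𝔩(S) = End(S)`
attribute [local instance 100] LieRing.ofAssociativeRing

namespace CahenWallach

noncomputable section

section Euclidean

variable (E : Type*) [NormedAddCommGroup E] [InnerProductSpace ℝ E]

/-- The negative definite scalar product `⟨·,·⟩` on the Euclidean summand `E` of Minkowski space:
minus the (positive) inner product of `E`. -/
def scalarE : LinearMap.BilinForm ℝ E := -(innerₗ E)

/-- Minkowski space `𝔪 = E ⊕ ℝ𝔭 ⊕ ℝ𝔮`; the triple `(e, s, t)` is `e + s𝔭 + t𝔮`. -/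
abbrev Minkowski : Type _ := E × ℝ × ℝ

/-- The scalar product of Minkowski space: it is `scalarE` on `E`, the vectors `𝔭, 𝔮` are isotropic
and orthogonal to `E`, and `⟨𝔭, 𝔮⟩ = 1`. -/
def scalarM : LinearMap.BilinForm ℝ (Minkowski E) :=
  LinearMap.mk₂ ℝ
    (fun v w => scalarE E v.1 w.1 + v.2.1 * w.2.2 + v.2.2 * w.2.1)
    (by intros; simp; ring) (by intros; simp; ring)
    (by intros; simp; ring) (by intros; simp; ring)

/-- The Clifford algebra `Cl(E)` with the convention `v² = -⟨v, v⟩`. -/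
abbrev ClE : Type _ := CliffordAlgebra (-(scalarE E).toQuadraticMap)

/-- The Clifford algebra `Cl(𝔪)` with the convention `v² = -⟨v, v⟩`. -/
abbrev ClM : Type _ := CliffordAlgebra (-(scalarM E).toQuadraticMap)

variable {E}

/-- The canonical inclusion `E → Cl(E)`. -/
abbrev ιE : E →ₗ[ℝ] ClE E := CliffordAlgebra.ι _

/-- The canonical inclusion `𝔪 → Cl(𝔪)`. -/
abbrev ιM : Minkowski E →ₗ[ℝ] ClM E := CliffordAlgebra.ι _

/-- The image `¼[v, w] ∈ Cl(E)` of `v ∧ w = ⟨v,·⟩w - ⟨w,·⟩v ∈ 𝔰𝔬(E)`. -/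
def wedgeE (v w : E) : ClE E := (1 / 4 : ℝ) • (ιE v * ιE w - ιE w * ιE v)

/-- The image `¼[v, w] ∈ Cl(𝔪)` of `v ∧ w = ⟨v,·⟩w - ⟨w,·⟩v ∈ 𝔰𝔬(𝔪)`. -/
def wedgeM (v w : Minkowski E) : ClM E := (1 / 4 : ℝ) • (ιM v * ιM w - ιM w * ιM v)

/-- The volume element `ω = e₁ ⋯ e_m ∈ Cl(E)` of an orthonormal basis of `E`. -/
def volumeElement {m : ℕ} (e : OrthonormalBasis (Fin m) ℝ E) : ClE E :=
  (List.ofFn fun i => ιE (e i)).prod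

theorem scalarE_apply (v w : E) : scalarE E v w = -(inner ℝ v w) := rfl

theorem scalarE_nondegenerate : (scalarE E).Nondegenerate := by
  constructor <;> intro v hv
  · simpa [scalarE_apply] using hv v
  · simpa [scalarE_apply] using hv v

end Euclidean

section Heisenberg

variable {E : Type*} [NormedAddCommGroup E] [InnerProductSpace ℝ E] [FiniteDimensional ℝ E]

/-- The musical isomorphism `e ↦ e^♭ = ⟨e, ·⟩`. -/
def flat : E ≃ₗ[ℝ] Module.Dual ℝ E :=
  LinearMap.BilinForm.toDual (scalarE E) scalarE_nondegenerate

/-- The endomorphism `B` of `E` with `b(v, w) = -⟨Bv, w⟩`. -/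
def opB (b : LinearMap.BilinForm ℝ E) : E →ₗ[ℝ] E :=
  -(flat.symm.toLinearMap ∘ₗ b)

/-- The underlying space of the Heisenberg algebra `𝔥𝔢𝔦𝔰_b = E^* + E + ℝ𝔭`;
the triple `(α, e, s)` is `α + e + s𝔭`. -/
def Heis (_b : LinearMap.BilinForm ℝ E) : Type _ := Module.Dual ℝ E × E × ℝ

variable (b : LinearMap.BilinForm ℝ E)

instance : AddCommGroup (Heis b) := inferInstanceAs (AddCommGroup (Module.Dual ℝ E × E × ℝ))

instance : Module ℝ (Heis b) := inferInstanceAs (Module ℝ (Module.Dual ℝ E × E × ℝ))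

/-- The inclusion `E^* → 𝔥𝔢𝔦𝔰_b`. -/
def Heis.ofDual : Module.Dual ℝ E →ₗ[ℝ] Heis b :=
  LinearMap.inl ℝ (Module.Dual ℝ E) (E × ℝ)

/-- The inclusion `E → 𝔥𝔢𝔦𝔰_b`. -/
def Heis.ofE : E →ₗ[ℝ] Heis b :=
  LinearMap.inr ℝ (Module.Dual ℝ E) (E × ℝ) ∘ₗ LinearMap.inl ℝ E ℝ

/-- The central element `𝔭` of `𝔥𝔢𝔦𝔰_b`. -/
def Heis.p : Heis b := ((0, 0, 1) : Module.Dual ℝ E × E × ℝ)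

/-- The only non-trivial brackets are `[e^♭, f] = b(e, f)𝔭 = -[f, e^♭]`. -/
instance : Bracket (Heis b) (Heis b) where
  bracket x y := (b (flat.symm x.1) y.2.1 - b (flat.symm y.1) x.2.1) • Heis.p b

theorem Heis.bracket_def (x y : Heis b) :
    ⁅x, y⁆ = (b (flat.symm x.1) y.2.1 - b (flat.symm y.1) x.2.1) • Heis.p b := rfl

set_option linter.unusedSectionVars false

theorem Heis.add_fst (x y : Heis b) : (x + y).1 = x.1 + y.1 := rfl
theorem Heis.add_mid (x y : Heis b) : (x + y).2.1 = x.2.1 + y.2.1 := rfl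
theorem Heis.smul_fst (r : ℝ) (x : Heis b) : (r • x).1 = r • x.1 := rfl
theorem Heis.smul_mid (r : ℝ) (x : Heis b) : (r • x).2.1 = r • x.2.1 := rfl
theorem Heis.p_fst : (Heis.p b).1 = 0 := rfl
theorem Heis.p_mid : (Heis.p b).2.1 = 0 := rfl

instance : LieRing (Heis b) where
  add_lie x y z := by
    simp only [Heis.bracket_def, Heis.add_fst, Heis.add_mid, map_add, LinearMap.add_apply]
    module
  lie_add x y z := by
    simp only [Heis.bracket_def, Heis.add_fst, Heis.add_mid, map_add, LinearMap.add_apply]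
    module
  lie_self x := by simp [Heis.bracket_def]
  leibniz_lie x y z := by
    simp [Heis.bracket_def, Heis.smul_fst, Heis.smul_mid, Heis.p_fst, Heis.p_mid]

instance : LieAlgebra ℝ (Heis b) where
  lie_smul r x y := by
    simp only [Heis.bracket_def, Heis.smul_fst, Heis.smul_mid, map_smul, LinearMap.smul_apply,
      smul_eq_mul]
    module

end Heisenberg

section Spin

variable {E : Type*} [NormedAddCommGroup E] [InnerProductSpace ℝ E]
variable (S₀ : Type*) [AddCommGroup S₀] [Module ℝ S₀] [Module (ClE E) S₀]
  [IsScalarTower ℝ (ClE E) S₀]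

/-- Clifford action of `Cl(E)` on the module `S₀`, by `ℝ`-linear endomorphisms. -/
def cliff : ClE E →ₐ[ℝ] Module.End ℝ S₀ := Algebra.lsmul ℝ ℝ S₀

/-- Clifford multiplication by vectors of `E`. -/
def vec : E →ₗ[ℝ] Module.End ℝ S₀ := (cliff S₀).toLinearMap ∘ₗ ιE

variable (E) in
/-- The Schur algebra: the endomorphisms of `S₀` that commute with the action of `𝔰𝔬(E)`. -/
def schurAlgebra : Subalgebra ℝ (Module.End ℝ S₀) :=
  Subalgebra.centralizer ℝ {A | ∃ v w : E, A = cliff S₀ (wedgeE v w)}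

variable {S₀}

/-- A para-complex structure on a real vector space: an involution whose eigenspaces for `1` and
`-1` have the same dimension. -/
def IsParaComplex (A : Module.End ℝ S₀) : Prop :=
  A * A = 1 ∧ Module.rank ℝ (A.eigenspace 1) = Module.rank ℝ (A.eigenspace (-1))

/-- The endomorphism of `S₀ × S₀` with the block matrix `(a₁₁ a₁₂ ; a₂₁ a₂₂)`, acting on columns
`(Q₋, Q₊)`. -/
def block (a₁₁ a₁₂ a₂₁ a₂₂ : Module.End ℝ S₀) : Module.End ℝ (S₀ × S₀) :=
  (a₁₁.coprod a₁₂).prod (a₂₁.coprod a₂₂)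

variable (S₀) in
/-- Clifford multiplication by vectors of `𝔪` on `S = S₋ + S₊ = S₀ × S₀`: on
`S_{1,1} ⊗ S₀` (graded tensor product), in the basis `𝔭/(2√2), 1` of `S_{1,1} = Λ(ℝ𝔭)`, the vector
`𝔭` acts by exterior multiplication, `𝔮` by minus the interior multiplication with `𝔮(𝔭) = 2`, and
`e ∈ E` by Clifford multiplication with the sign of the grading. -/
def vecM : Minkowski E →ₗ[ℝ] Module.End ℝ (S₀ × S₀) where
  toFun v := block (-(vec S₀ v.1)) ((2 * √2 * v.2.1) • 1) (-(v.2.2 / √2) • 1) (vec S₀ v.1)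
  map_add' v w := by
    ext x <;> simp [block] <;> module
  map_smul' r v := by
    ext x <;> simp [block] <;> module

theorem vec_vec (v : E) (x : S₀) : vec S₀ v (vec S₀ v x) = (inner ℝ v v : ℝ) • x := by
  have h : vec S₀ v * vec S₀ v = algebraMap ℝ _ (inner ℝ v v : ℝ) := by
    simp only [vec, LinearMap.comp_apply, AlgHom.toLinearMap_apply, ← map_mul,
      CliffordAlgebra.ι_sq_scalar, AlgHom.commutes]
    simp [scalarE_apply]
  exact congrArg (fun A : Module.End ℝ S₀ => A x) h

theorem vecM_sq (v : Minkowski E) :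
    vecM S₀ v * vecM S₀ v =
      algebraMap ℝ (Module.End ℝ (S₀ × S₀)) ((-(scalarM E).toQuadraticMap) v) := by
  have h2 : (√2 : ℝ) * (√2)⁻¹ = 1 := mul_inv_cancel₀ (by positivity)
  have h : 2 * √2 * v.2.1 * (v.2.2 / √2) = 2 * v.2.1 * v.2.2 := by
    rw [div_eq_mul_inv]; linear_combination (2 * v.2.1 * v.2.2) * h2
  have hq : (-(scalarM E).toQuadraticMap) v = inner ℝ v.1 v.1 - 2 * v.2.1 * v.2.2 := by
    simp [scalarM, scalarE_apply]; ring
  rw [hq]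
  refine LinearMap.ext fun x => Prod.ext ?_ ?_
  · rw [Module.algebraMap_end_apply]
    simp [vecM, block, vec_vec, smul_smul]
    rw [h]; module
  · rw [Module.algebraMap_end_apply]
    simp [vecM, block, vec_vec, smul_smul]
    rw [mul_comm (v.2.2 / √2), h]; module

variable (S₀) in
/-- The spin representation `ρ_spin : Cl(𝔪) → End(S)`, on `S = S₀ × S₀`. -/
def spinRep : ClM E →ₐ[ℝ] Module.End ℝ (S₀ × S₀) :=
  CliffordAlgebra.lift _ ⟨vecM S₀, vecM_sq⟩

/-- The spin module `S = S₀ × S₀` is an irreducible `Cl(𝔪)`-module when `S₀` is an irreducible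
`Cl(E)`-module. -/
theorem spinRep_irreducible [IsSimpleModule (ClE E) S₀] (W : Submodule ℝ (S₀ × S₀))
    (hW : ∀ (c : ClM E), ∀ x ∈ W, spinRep S₀ c x ∈ W) : W = ⊥ ∨ W = ⊤ := by
  have hv : ∀ (v : Minkowski E), ∀ x ∈ W, vecM S₀ v x ∈ W := fun v x hx => by
    have := hW (ιM v) x hx
    simpa [spinRep, CliffordAlgebra.lift_ι_apply] using this
  have s2 : (√2:ℝ) ≠ 0 := by positivity
  have hp : ∀ x ∈ W, ((x.2, 0) : S₀ × S₀) ∈ W := fun x hx => by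
    have := W.smul_mem (2 * √2)⁻¹ (hv (0, 1, 0) x hx)
    have h1 : (√2)⁻¹ * 2⁻¹ * (2 * √2) = (1 : ℝ) := by field_simp
    simpa [vecM, block, smul_smul, h1] using this
  have hq : ∀ x ∈ W, ((0, x.1) : S₀ × S₀) ∈ W := fun x hx => by
    have := W.smul_mem (-√2) (hv (0, 0, 1) x hx)
    simpa [vecM, block, smul_smul, s2] using this
  let U : Submodule (ClE E) S₀ :=
    { carrier := {y | ((0, y) : S₀ × S₀) ∈ W}
      zero_mem' := W.zero_mem
      add_mem' := fun {a b} ha hb => by simpa using W.add_mem ha hb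
      smul_mem' := fun c y hy => by
        induction c using CliffordAlgebra.induction generalizing y with
        | algebraMap r =>
          have := W.smul_mem r hy
          simpa [algebraMap_smul] using this
        | ι v =>
          have := hv (v, 0, 0) _ hy
          simpa [vecM, block, vec, cliff] using this
        | mul a b ha hb => rw [mul_smul]; exact ha _ (hb _ hy)
        | add a b ha hb =>
          rw [add_smul]
          have := W.add_mem (ha _ hy) (hb _ hy)
          simpa using this }
  rcases eq_bot_or_eq_top U with h | h
  · left
    rw [eq_bot_iff]
    intro x hx
    have h1 : x.1 ∈ U := hq x hx
    have h2 : x.2 ∈ U := hq _ (hp x hx)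
    rw [h] at h1 h2
    exact Prod.ext h1 h2
  · right
    rw [eq_top_iff]
    intro x _
    have h1 : x.1 ∈ U := by rw [h]; trivial
    have h2 : x.2 ∈ U := by rw [h]; trivial
    have := W.add_mem (hp _ h1) h2
    simpa using this

/-- `ρ₁₂` is `(ρ₁₁, ρ₂₂)`-suitable: the bilinear map
`(e, f) ↦ ρ₁₁(e) ∘ ρ₁₂(f) - ρ₁₂(f) ∘ ρ₂₂(e)` is symmetric. -/
def IsSuitable (ρ₁₁ ρ₂₂ ρ₁₂ : E →ₗ[ℝ] Module.End ℝ S₀) : Prop :=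
  ∀ e f : E, ρ₁₁ e * ρ₁₂ f - ρ₁₂ f * ρ₂₂ e = ρ₁₁ f * ρ₁₂ e - ρ₁₂ e * ρ₂₂ f

variable [FiniteDimensional ℝ E] {b : LinearMap.BilinForm ℝ E}

/-- A representation of `𝔥𝔢𝔦𝔰_b` on `S` is spin if `e^♭` acts as the element `𝔭 ∧ Be` of `𝔰𝔬(𝔪)`
does in the spin representation. -/
def IsSpin (ρ : Heis b →ₗ⁅ℝ⁆ Module.End ℝ (S₀ × S₀)) : Prop :=
  ∀ e : E, ρ (Heis.ofDual b (flat e)) = spinRep S₀ (wedgeM (0, 1, 0) (opB b e, 0, 0))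

/-- The diagonal blocks `e ↦ ½ (h₃(e) Id + c e + s e𝓔)`, where `e𝓔` is `𝓔` followed by Clifford
multiplication by `e`. -/
def diagBlock (𝓔 : Module.End ℝ S₀) (c s : ℝ) (h₃ : Module.Dual ℝ E) :
    E →ₗ[ℝ] Module.End ℝ S₀ :=
  (1 / 2 : ℝ) • (h₃.smulRight 1 + c • vec S₀ + s • (LinearMap.mulRight ℝ 𝓔 ∘ₗ vec S₀))

end Spin

end

end CahenWallach

/-! The crux is that, when m = n - 1 is a positive multiple of 8, S₀ is of real type: an
endomorphism commuting with all Clifford vectors is a real scalar (`eq_smul_one_of_commute_basis`).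
A Bott-periodicity argument (`isSplitSignature_replicate`) shows that m anticommuting square roots
of 1 generate an algebra 𝓑 containing an idempotent P ≠ 0 with P𝓑P = ℝP. An X in the commutant
commutes with P, hence acts on a vector Py ≠ 0 by a scalar, and simplicity spreads this scalar over
S₀.

Since m is even, the volume element ω anticommutes with every vector, and ω² = 1 because m(m-1)/2 is
even. A vector of square 1 then exchanges the eigenspaces of ω. Real type places the Schur algebra
inside ℝ1 + ℝω, where a para-complex element must be a multiple of ω. So every admissible 𝓔 squares
to 1, anticommutes with vectors and differs from ±1, which is all that is used of it afterwards.

In a spin representation ρ(e^♭) is strictly upper triangular with corner √2 Be, and non-degeneracy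
of b makes u = Be arbitrary. The bracket with ρ(v) kills the lower left block of ρ(v), gives ρ(p) =
√2 K in the upper right corner, and leaves uF(v) - A(v)u = (u,v)K for the diagonal blocks A, F. On
an orthonormal basis, centralizer computations, commutativity of the A(v) and K ≠ 0 force the stated
form (`diagonal_blocks_of_intertwining`). The corner of [ρ(u), ρ(v)] = 0 is exactly suitability.
Conversely, the same block relations hold for the given formulas and yield the bracket
(`existsUnique_isSpin`). -/

namespace CahenWallach

/-! ### Bott periodicity: primitive idempotents from anticommuting elements -/

section CliffordSystems

variable {A : Type*} [Ring A] [Algebra ℝ A]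

theorem eq_zero_of_eq_neg {M : Type*} [AddCommGroup M] [Module ℝ M] {x : M} (h : x = -x) :
    x = 0 := by
  have h2 : (2 : ℝ) • x = 0 := by rw [two_smul]; exact eq_neg_iff_add_eq_zero.1 h
  exact (smul_eq_zero_iff_right two_ne_zero).1 h2

/-- A subalgebra contains an idempotent `P` with `P B P = ℝ P`. -/
def HasPrimitiveIdempotent (B : Subalgebra ℝ A) : Prop :=
  ∃ P ∈ B, P ≠ 0 ∧ P * P = P ∧ ∀ x ∈ B, ∃ r : ℝ, P * x * P = r • P

/-- Pairwise anticommuting elements whose squares are the prescribed scalars. -/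
structure IsCliffordSystem (l : List A) (σ : List ℝ) : Prop where
  sq : List.Forall₂ (fun x s => x * x = s • 1) l σ
  anti : l.Pairwise fun x y => x * y = -(y * x)

variable (A) in
/-- Every Clifford system in `A` with the given squares generates a subalgebra with a primitive
idempotent. -/
def IsSplitSignature (σ : List ℝ) : Prop :=
  ∀ l : List A, IsCliffordSystem l σ → HasPrimitiveIdempotent (Algebra.adjoin ℝ {x | x ∈ l})

theorem isSplitSignature_nil [Nontrivial A] : IsSplitSignature A [] := by
  rintro l ⟨hsq, -⟩
  rw [List.forall₂_nil_right_iff] at hsq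
  subst hsq
  refine ⟨1, one_mem _, one_ne_zero, one_mul 1, fun x hx => ?_⟩
  have : {x : A | x ∈ ([] : List A)} = ∅ := by ext; simp
  rw [this, Algebra.adjoin_empty, Algebra.mem_bot] at hx
  obtain ⟨r, rfl⟩ := hx
  exact ⟨r, by simp [Algebra.algebraMap_eq_smul_one]⟩

/-- If `a`, `b` anticommute with each other and commute with `C`, the algebra generated by `a`, `b`
and `C` is `C + a C + b C + a b C`. -/
theorem adjoin_pair_decomposition {a b : A} {ε : ℝ} (ha : a * a = 1) (hb : b * b = ε • 1)
    (hab : b * a = -(a * b)) {C : Subalgebra ℝ A} (hCa : ∀ y ∈ C, y * a = a * y)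
    (hCb : ∀ y ∈ C, y * b = b * y) {s : Set A}
    (hs : ∀ x ∈ s, x = a ∨ x = b ∨ ∃ (r : ℝ), ∃ y ∈ C, x = r • (a * b * y)) {x : A}
    (hx : x ∈ Algebra.adjoin ℝ s) :
    ∃ y₀ ∈ C, ∃ y₁ ∈ C, ∃ y₂ ∈ C, ∃ y₃ ∈ C, x = y₀ + a * y₁ + b * y₂ + a * b * y₃ := by
  let M (z : A) : Prop :=
    ∃ y₀ ∈ C, ∃ y₁ ∈ C, ∃ y₂ ∈ C, ∃ y₃ ∈ C, z = y₀ + a * y₁ + b * y₂ + a * b * y₃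
  have hMa : ∀ z, M z → M (a * z) := by
    rintro z ⟨y₀, h₀, y₁, h₁, y₂, h₂, y₃, h₃, rfl⟩
    refine ⟨y₁, h₁, y₀, h₀, y₃, h₃, y₂, h₂, ?_⟩
    have ha' : ∀ z, a * (a * z) = z := fun z => by rw [← mul_assoc, ha, one_mul]
    simp only [mul_add, mul_assoc, ha']
    abel
  have hMb : ∀ z, M z → M (b * z) := by
    rintro z ⟨y₀, h₀, y₁, h₁, y₂, h₂, y₃, h₃, rfl⟩
    refine ⟨ε • y₂, C.smul_mem h₂ _, -(ε • y₃), C.neg_mem (C.smul_mem h₃ _), y₀, h₀,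
      -y₁, C.neg_mem h₁, ?_⟩
    have hb' : ∀ z, b * (b * z) = ε • z := fun z => by
      rw [← mul_assoc, hb, smul_mul_assoc, one_mul]
    have hab' : ∀ z, b * (a * z) = -(a * (b * z)) := fun z => by
      rw [← mul_assoc, hab, neg_mul, mul_assoc]
    simp only [mul_add, mul_assoc, hab', hb', mul_neg, mul_smul_comm]
    abel
  have hMC : ∀ c ∈ C, ∀ z, M z → M (c * z) := by
    rintro c hc z ⟨y₀, h₀, y₁, h₁, y₂, h₂, y₃, h₃, rfl⟩
    refine ⟨c * y₀, C.mul_mem hc h₀, c * y₁, C.mul_mem hc h₁, c * y₂, C.mul_mem hc h₂,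
      c * y₃, C.mul_mem hc h₃, ?_⟩
    have ha' : ∀ z, c * (a * z) = a * (c * z) := fun z => by
      rw [← mul_assoc, hCa c hc, mul_assoc]
    have hb' : ∀ z, c * (b * z) = b * (c * z) := fun z => by
      rw [← mul_assoc, hCb c hc, mul_assoc]
    simp only [mul_add, mul_assoc, ha', hb']
  have hMadd : ∀ z w, M z → M w → M (z + w) := by
    rintro z w ⟨y₀, h₀, y₁, h₁, y₂, h₂, y₃, h₃, rfl⟩ ⟨z₀, k₀, z₁, k₁, z₂, k₂, z₃, k₃, rfl⟩
    refine ⟨y₀ + z₀, C.add_mem h₀ k₀, y₁ + z₁, C.add_mem h₁ k₁, y₂ + z₂, C.add_mem h₂ k₂,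
      y₃ + z₃, C.add_mem h₃ k₃, ?_⟩
    simp only [mul_add]
    abel
  have key : ∀ z, M z → M (x * z) := by
    induction hx using Algebra.adjoin_induction with
    | mem x hx =>
      intro z hz
      obtain rfl | rfl | ⟨r, y, hy, rfl⟩ := hs x hx
      · exact hMa z hz
      · exact hMb z hz
      · rw [← mul_smul_comm, mul_assoc, mul_assoc]
        exact hMa _ (hMb _ (hMC _ (C.smul_mem hy r) _ hz))
    | algebraMap r => exact hMC _ (C.algebraMap_mem r)
    | add u v _ _ hu hv =>
      intro z hz
      rw [add_mul]
      exact hMadd _ _ (hu z hz) (hv z hz)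
    | mul u v _ _ hu hv =>
      intro z hz
      rw [mul_assoc]
      exact hu _ (hv z hz)
  have h1 : M 1 := ⟨1, C.one_mem, 0, C.zero_mem, 0, C.zero_mem, 0, C.zero_mem, by simp⟩
  simpa using key 1 h1

/-- The pair a, b spans a copy of the 2×2 real matrices commuting with C, and ½(1 + a) is a rank-one
projection there. Multiplying it by a primitive idempotent Q of C gives one of the whole algebra:
½(1 + a) annihilates b and ab from both sides and absorbs a, so only Q(y₀ + y₁)Q survives. -/
theorem HasPrimitiveIdempotent.of_pair {a b : A} {ε : ℝ} (hε : ε ≠ 0) (ha : a * a = 1)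
    (hb : b * b = ε • 1) (hab : b * a = -(a * b)) {C : Subalgebra ℝ A}
    (hCa : ∀ y ∈ C, y * a = a * y) (hCb : ∀ y ∈ C, y * b = b * y) {s : Set A}
    (has : a ∈ s) (hCs : C ≤ Algebra.adjoin ℝ s)
    (hs : ∀ x ∈ s, x = a ∨ x = b ∨ ∃ (r : ℝ), ∃ y ∈ C, x = r • (a * b * y))
    (hC : HasPrimitiveIdempotent C) : HasPrimitiveIdempotent (Algebra.adjoin ℝ s) := by
  obtain ⟨Q, hQ, hQ0, hQQ, hQC⟩ := hC
  have ha' : ∀ z, a * (a * z) = z := fun z => by rw [← mul_assoc, ha, one_mul]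
  have hab' : ∀ z, b * (a * z) = -(a * (b * z)) := fun z => by
    rw [← mul_assoc, hab, neg_mul, mul_assoc]
  have hQa := hCa Q hQ
  have hQb := hCb Q hQ
  have hQa' : ∀ z, Q * (a * z) = a * (Q * z) := fun z => by rw [← mul_assoc, hQa, mul_assoc]
  have hQb' : ∀ z, Q * (b * z) = b * (Q * z) := fun z => by rw [← mul_assoc, hQb, mul_assoc]
  have hQQ' : ∀ z, Q * (Q * z) = Q * z := fun z => by rw [← mul_assoc, hQQ]
  refine ⟨(1 / 2 : ℝ) • (Q + a * Q), ?_, ?_, ?_, ?_⟩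
  · exact Subalgebra.smul_mem _ (add_mem (hCs hQ)
      (mul_mem (Algebra.subset_adjoin has) (hCs hQ))) _
  · intro h
    -- Multiplication by the invertible b, which commutes with Q, exchanges the two eigenvalues of
    -- a. Hence aQ = -Q would force bQ = 0 and then Q = 0.
    have h1 : a * Q = -Q := by
      rw [smul_eq_zero_iff_right (by norm_num)] at h
      exact (neg_eq_of_add_eq_zero_right h).symm
    have h2 : a * (b * Q) = b * Q := by
      have := congrArg (b * ·) h1
      simp only [hab', mul_neg, neg_inj] at this
      exact this
    have h3 : a * (b * Q) = -(b * Q) := by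
      rw [← hQb, ← mul_assoc, h1, neg_mul]
    have h4 : b * Q = 0 := by
      rw [h2] at h3
      exact eq_zero_of_eq_neg h3
    apply hQ0
    have := congrArg (b * ·) h4
    simp only [← mul_assoc, hb, mul_zero, smul_mul_assoc, one_mul] at this
    exact (smul_eq_zero_iff_right hε).1 this
  · simp only [smul_mul_smul_comm, mul_add, add_mul, mul_assoc, hQa', hQQ, ha']
    module
  · intro x hx
    obtain ⟨y₀, h₀, y₁, h₁, y₂, h₂, y₃, h₃, rfl⟩ :=
      adjoin_pair_decomposition ha hb hab hCa hCb hs hx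
    obtain ⟨r, hr⟩ := hQC (y₀ + y₁) (add_mem h₀ h₁)
    refine ⟨r, ?_⟩
    have hr' : Q * (y₀ * Q) + Q * (y₁ * Q) = r • Q := by
      rw [← hr]; simp only [mul_add, add_mul, mul_assoc]
    have comm : ∀ y ∈ C, ∀ z, y * (a * z) = a * (y * z) := fun y hy z => by
      rw [← mul_assoc, hCa y hy, mul_assoc]
    have e : r • ((1 / 2 : ℝ) • (Q + a * Q)) =
        (1 / 2 : ℝ) • ((Q * (y₀ * Q) + Q * (y₁ * Q)) + a * (Q * (y₀ * Q) + Q * (y₁ * Q))) := by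
      rw [hr', mul_smul_comm]; module
    rw [e]
    simp only [smul_mul_assoc, mul_smul_comm, mul_add, add_mul, mul_assoc, hQa', hQb', ha', hab',
      comm _ h₀, comm _ h₁, comm _ h₂, comm _ h₃, mul_neg]
    module

/-- Twisting each remaining generator x to abx makes it commute with a and b, preserves
anticommutation among the twisted generators, and multiplies the square by -(ab)-type sign: (abx)² =
-εx². The 2×2 factor generated by a, b then splits off. -/
theorem IsSplitSignature.cons_cons {ε : ℝ} (hε : ε ≠ 0) {σ : List ℝ}
    (h : IsSplitSignature A (σ.map (-ε * ·))) : IsSplitSignature A (1 :: ε :: σ) := by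
  rintro l ⟨hsq, hanti⟩
  obtain _ | @⟨a, _, _, _, ha, _ | @⟨b, _, l, _, hb, hsq⟩⟩ := hsq
  rw [one_smul] at ha
  simp only [List.pairwise_cons, List.mem_cons, forall_eq_or_imp] at hanti
  obtain ⟨⟨hab, hal⟩, hbl, hl⟩ := hanti
  have hba : b * a = -(a * b) := by rw [hab, neg_neg]
  have ha' : ∀ z, a * (a * z) = z := fun z => by rw [← mul_assoc, ha, one_mul]
  have hb' : ∀ z, b * (b * z) = ε • z := fun z => by
    rw [← mul_assoc, hb, smul_mul_assoc, one_mul]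
  have hba' : ∀ z, b * (a * z) = -(a * (b * z)) := fun z => by
    rw [← mul_assoc, hba, neg_mul, mul_assoc]
  have hla : ∀ x ∈ l, x * a = -(a * x) := fun x hx => by rw [hal x hx, neg_neg]
  have hlb : ∀ x ∈ l, x * b = -(b * x) := fun x hx => by rw [hbl x hx, neg_neg]
  have hla' : ∀ x ∈ l, ∀ z, x * (a * z) = -(a * (x * z)) := fun x hx z => by
    rw [← mul_assoc, hla x hx, neg_mul, mul_assoc]
  have hlb' : ∀ x ∈ l, ∀ z, x * (b * z) = -(b * (x * z)) := fun x hx z => by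
    rw [← mul_assoc, hlb x hx, neg_mul, mul_assoc]
  have hprod : ∀ x ∈ l, ∀ y, (a * b * x) * (a * b * y) = -(ε • (x * y)) := fun x hx y => by
    simp only [mul_assoc, hla' x hx, hlb' x hx, mul_neg, neg_neg, hba', hb', ha', mul_smul_comm]
  have hsys : IsCliffordSystem (l.map (a * b * ·)) (σ.map (-ε * ·)) := by
    constructor
    · rw [List.forall₂_map_left_iff, List.forall₂_map_right_iff]
      rw [List.forall₂_iff_get] at hsq ⊢
      refine ⟨hsq.1, fun i h₁ h₂ => ?_⟩
      rw [hprod _ (List.get_mem l _), hsq.2 i h₁ h₂]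
      module
    · rw [List.pairwise_map]
      refine hl.imp_of_mem fun {x y} hx hy hxy => ?_
      rw [hprod x hx, hprod y hy, hxy]
      module
  refine HasPrimitiveIdempotent.of_pair hε ha hb hba ?_ ?_ (by simp) ?_ ?_ (h _ hsys)
  · intro y hy
    have : y ∈ Subalgebra.centralizer ℝ {a} := by
      refine Algebra.adjoin_le ?_ hy
      rintro _ hx'
      obtain ⟨x, hx, rfl⟩ := List.mem_map.1 hx'
      rw [SetLike.mem_coe, Subalgebra.mem_centralizer_iff]
      intro c hc
      rw [Set.mem_singleton_iff.1 hc]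
      simp only [mul_assoc, hla x hx, mul_neg, hba', neg_neg]
    rw [Subalgebra.mem_centralizer_iff] at this
    exact (this a rfl).symm
  · intro y hy
    have : y ∈ Subalgebra.centralizer ℝ {b} := by
      refine Algebra.adjoin_le ?_ hy
      rintro _ hx'
      obtain ⟨x, hx, rfl⟩ := List.mem_map.1 hx'
      rw [SetLike.mem_coe, Subalgebra.mem_centralizer_iff]
      intro c hc
      rw [Set.mem_singleton_iff.1 hc]
      simp only [mul_assoc, hlb x hx, mul_neg, hba']
    rw [Subalgebra.mem_centralizer_iff] at this
    exact (this b rfl).symm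
  · refine Algebra.adjoin_le ?_
    rintro _ hx'
    obtain ⟨x, hx, rfl⟩ := List.mem_map.1 hx'
    exact mul_mem (mul_mem (Algebra.subset_adjoin (by simp)) (Algebra.subset_adjoin (by simp)))
      (Algebra.subset_adjoin (by simp [hx]))
  · intro x hx
    simp only [Set.mem_ofPred_eq, List.mem_cons] at hx
    obtain rfl | rfl | hx := hx
    · exact .inl rfl
    · exact .inr (.inl rfl)
    · refine .inr (.inr ⟨-ε⁻¹, _, Algebra.subset_adjoin (List.mem_map_of_mem hx), ?_⟩)
      simp only [mul_assoc, hba', hb', mul_neg, mul_smul_comm, ha', smul_neg, smul_smul]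
      rw [neg_mul, inv_mul_cancel₀ hε, neg_smul, one_smul, neg_neg]

/-- With ω = abcd one has ω² = 1, and ω anticommutes with a, b, c, d but commutes with the other
generators. Replacing the first four generators x by ωx turns their squares from -1 to 1 without
changing the generated algebra. The generators e and f are interleaved only so that the new list
starts with pairs (1, -1) ready for splitting. -/
theorem IsSplitSignature.of_six {σ : List ℝ}
    (h : IsSplitSignature A (1 :: -1 :: 1 :: -1 :: 1 :: 1 :: σ)) :
    IsSplitSignature A (-1 :: -1 :: -1 :: -1 :: -1 :: -1 :: σ) := by
  rintro l ⟨hsq, hanti⟩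
  obtain _ | @⟨a, _, _, _, ha, _ | @⟨b, _, _, _, hb, _ | @⟨c, _, _, _, hc, _ | @⟨d, _, _, _, hd,
    _ | @⟨e, _, _, _, he, _ | @⟨f, _, l, _, hf, hsq⟩⟩⟩⟩⟩⟩ := hsq
  rw [neg_smul, one_smul] at ha hb hc hd
  simp only [List.pairwise_cons, List.mem_cons, forall_eq_or_imp] at hanti
  obtain ⟨⟨hab, hac, had, hae, haf, hal⟩, ⟨hbc, hbd, hbe, hbf, hbl⟩, ⟨hcd, hce, hcf, hcl⟩,
    ⟨hde, hdf, hdl⟩, ⟨hef, hel⟩, hfl, hl⟩ := hanti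
  have left : ∀ {x y : A}, x * y = -(y * x) → ∀ z, x * (y * z) = -(y * (x * z)) :=
    fun {x y} h z => by rw [← mul_assoc, h, neg_mul, mul_assoc]
  have flip : ∀ {x y : A}, x * y = -(y * x) → y * x = -(x * y) := fun h => by rw [h, neg_neg]
  have sq' : ∀ {x : A}, x * x = -1 → ∀ z, x * (x * z) = -z :=
    fun {x} h z => by rw [← mul_assoc, h, neg_mul, one_mul]
  obtain ⟨ω, hω⟩ : ∃ ω, ω = a * b * c * d := ⟨_, rfl⟩
  have hωω : ω * ω = 1 := by
    simp only [hω, mul_assoc, left (flip hab), left (flip hac), left (flip had), left (flip hbc),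
      left (flip hbd), left (flip hcd), ha, hb, hc, hd, mul_neg, neg_neg, mul_one]
  have hωω' : ∀ z, ω * (ω * z) = z := fun z => by rw [← mul_assoc, hωω, one_mul]
  have hωa : a * ω = -(ω * a) := by
    simp only [hω, mul_assoc, flip had, left (flip hab), left (flip hac), sq' ha, mul_neg, neg_neg]
  have hωb : b * ω = -(ω * b) := by
    simp only [hω, mul_assoc, flip hbd, left (flip hab), left (flip hbc), sq' hb, mul_neg, neg_neg]
  have hωc : c * ω = -(ω * c) := by
    simp only [hω, mul_assoc, flip hcd, left (flip hac), left (flip hbc), sq' hc, mul_neg, neg_neg]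
  have hωd : d * ω = -(ω * d) := by
    simp only [hω, mul_assoc, left (flip had), left (flip hbd),
      left (flip hcd), hd, mul_neg, neg_neg]
  have hω4 : ∀ x, a * x = -(x * a) → b * x = -(x * b) → c * x = -(x * c) → d * x = -(x * d) →
      x * ω = ω * x := fun x hxa hxb hxc hxd => by
    simp only [hω, mul_assoc, left (flip hxa), left (flip hxb), left (flip hxc), flip hxd,
      mul_neg, neg_neg]
  have hmul : ∀ {x : A}, x * ω = -(ω * x) → ∀ y, (ω * x) * (ω * y) = -(x * y) := fun {x} hx y => by
    rw [mul_assoc, left hx, mul_neg, hωω']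
  have hsq1 : ∀ {x : A}, x * ω = -(ω * x) → x * x = -1 → (ω * x) * (ω * x) = (1 : ℝ) • 1 :=
    fun {x} hx h => by rw [hmul hx, h, neg_neg, one_smul]
  have hanti1 : ∀ {x y : A}, x * ω = -(ω * x) → y * ω = -(ω * y) → x * y = -(y * x) →
      (ω * x) * (ω * y) = -((ω * y) * (ω * x)) := fun {x y} hx hy h => by
    rw [hmul hx, hmul hy, h]
  have hanti2 : ∀ {x y : A}, y * ω = ω * y → x * y = -(y * x) → (ω * x) * y = -(y * (ω * x)) :=
    fun {x y} hy h => by rw [← mul_assoc, hy, mul_assoc, h, mul_assoc, mul_neg]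
  have hωe := hω4 e hae hbe hce hde
  have hωf := hω4 f haf hbf hcf hdf
  have hωl : ∀ x ∈ l, x * ω = ω * x := fun x hx =>
    hω4 x (hal x hx) (hbl x hx) (hcl x hx) (hdl x hx)
  have hsys : IsCliffordSystem (ω * a :: e :: ω * b :: f :: ω * c :: ω * d :: l)
      (1 :: -1 :: 1 :: -1 :: 1 :: 1 :: σ) := by
    constructor
    · exact .cons (hsq1 hωa ha) (.cons he (.cons (hsq1 hωb hb) (.cons hf (.cons (hsq1 hωc hc)
        (.cons (hsq1 hωd hd) hsq)))))
    · simp only [List.pairwise_cons, List.mem_cons, forall_eq_or_imp]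
      exact ⟨⟨hanti2 hωe hae, hanti1 hωa hωb hab, hanti2 hωf haf, hanti1 hωa hωc hac,
          hanti1 hωa hωd had, fun x hx => hanti2 (hωl x hx) (hal x hx)⟩,
        ⟨flip (hanti2 hωe hbe), hef, flip (hanti2 hωe hce), flip (hanti2 hωe hde), hel⟩,
        ⟨hanti2 hωf hbf, hanti1 hωb hωc hbc, hanti1 hωb hωd hbd,
          fun x hx => hanti2 (hωl x hx) (hbl x hx)⟩,
        ⟨flip (hanti2 hωf hcf), flip (hanti2 hωf hdf), hfl⟩,
        ⟨hanti1 hωc hωd hcd, fun x hx => hanti2 (hωl x hx) (hcl x hx)⟩,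
        fun x hx => hanti2 (hωl x hx) (hdl x hx), hl⟩
  have hadj : Algebra.adjoin ℝ {x | x ∈ ω * a :: e :: ω * b :: f :: ω * c :: ω * d :: l} =
      Algebra.adjoin ℝ {x | x ∈ a :: b :: c :: d :: e :: f :: l} := by
    apply le_antisymm
    · have mem : ∀ x, x ∈ a :: b :: c :: d :: e :: f :: l →
          x ∈ Algebra.adjoin ℝ {x | x ∈ a :: b :: c :: d :: e :: f :: l} :=
        fun x hx => Algebra.subset_adjoin hx
      have memω : ω ∈ Algebra.adjoin ℝ {x | x ∈ a :: b :: c :: d :: e :: f :: l} := by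
        rw [hω]
        exact mul_mem (mul_mem (mul_mem (mem a (by simp)) (mem b (by simp))) (mem c (by simp)))
          (mem d (by simp))
      refine Algebra.adjoin_le fun x hx => ?_
      simp only [Set.mem_ofPred_eq, List.mem_cons] at hx
      obtain rfl | rfl | rfl | rfl | rfl | rfl | hx := hx
      · exact mul_mem memω (mem a (by simp))
      · exact mem _ (by simp)
      · exact mul_mem memω (mem b (by simp))
      · exact mem _ (by simp)
      · exact mul_mem memω (mem c (by simp))
      · exact mul_mem memω (mem d (by simp))
      · exact mem _ (by simp [hx])
    · set B := Algebra.adjoin ℝ {x | x ∈ ω * a :: e :: ω * b :: f :: ω * c :: ω * d :: l}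
      have mem : ∀ x, x ∈ ω * a :: e :: ω * b :: f :: ω * c :: ω * d :: l → x ∈ B :=
        fun x hx => Algebra.subset_adjoin hx
      -- This recovers ω from the new generators; since ω² = 1, the old ones follow.
      have eω : ω = (ω * a) * (ω * b) * ((ω * c) * (ω * d)) := by
        rw [hmul hωa, hmul hωc, neg_mul_neg, hω, mul_assoc, mul_assoc]
      have memω : ω ∈ B := by
        rw [eω]
        exact mul_mem (mul_mem (mem _ (by simp)) (mem _ (by simp)))
          (mul_mem (mem _ (by simp)) (mem _ (by simp)))
      have memx : ∀ x, ω * x ∈ B → x ∈ B := fun x hx => by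
        simpa only [hωω'] using mul_mem memω hx
      refine Algebra.adjoin_le fun x hx => ?_
      simp only [Set.mem_ofPred_eq, List.mem_cons] at hx
      obtain rfl | rfl | rfl | rfl | rfl | rfl | hx := hx
      · exact memx _ (mem _ (by simp))
      · exact memx _ (mem _ (by simp))
      · exact memx _ (mem _ (by simp))
      · exact memx _ (mem _ (by simp))
      · exact mem _ (by simp)
      · exact mem _ (by simp)
      · exact mem _ (by simp [hx])
  rw [← hadj]
  exact h _ hsys

variable (A) in
/-- Positive definite Clifford algebras of dimension divisible by eight are split. -/
theorem isSplitSignature_replicate [Nontrivial A] (k : ℕ) :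
    IsSplitSignature A (List.replicate (8 * k) 1) := by
  induction k with
  | zero => exact isSplitSignature_nil
  | succ k ih =>
    have h8 : 8 * (k + 1) = 8 * k + 1 + 1 + 1 + 1 + 1 + 1 + 1 + 1 := by ring
    rw [h8]
    simp only [List.replicate_succ]
    -- Writing + and - for squares 1 and -1, with N the remaining 8k entries: the signature +⁸N₊
    -- becomes -⁶N₋, then (+-+-++)N₋, then (+-++)N₋, then (++)N₋, and finally N₊, the induction
    -- hypothesis.
    refine .cons_cons one_ne_zero ?_
    simp only [List.map_cons, mul_one]
    refine .of_six (.cons_cons (by norm_num) ?_)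
    simp only [List.map_cons, neg_neg, one_mul]
    refine .cons_cons (by norm_num) ?_
    simp only [List.map_cons, neg_neg, one_mul]
    refine .cons_cons one_ne_zero ?_
    simpa [Function.comp_def] using ih

end CliffordSystems

/-! ### Centralizers of partial families and the intertwining equations -/

section Centralizers

variable {A : Type*} [Ring A] [Algebra ℝ A] {ι : Type*} {c : ι → A} {ε : A}

/-- Conjugation by a fixes 1 and negates ε, so the two are linearly independent. -/
theorem smul_one_add_smul_eq_zero [Nontrivial A] {a : A} (ha : a * a = 1) (hε : ε * ε = 1)
    (haε : a * ε = -(ε * a)) {r t : ℝ} (h : r • 1 + t • ε = 0) : r = 0 ∧ t = 0 := by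
  have hconj : a * (ε * a) = -ε := by
    rw [← neg_eq_iff_eq_neg.2 haε, mul_neg, ← mul_assoc, ha, one_mul]
  have h' : r • 1 - t • ε = 0 := by
    have := congrArg (fun z => a * (z * a)) h
    simpa only [add_mul, mul_add, smul_mul_assoc, mul_smul_comm, one_mul, ha, hconj, smul_neg,
      zero_mul, mul_zero, ← sub_eq_add_neg] using this
  have hr : (2 * r) • (1 : A) = 0 := by
    rw [← add_zero (0 : A)]
    nth_rw 1 [← h]
    rw [← h']
    module
  have hr0 : r = 0 := by simpa using hr
  refine ⟨hr0, ?_⟩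
  rw [hr0, zero_smul, zero_add] at h
  have hε0 : ε ≠ 0 := by
    rintro rfl
    simp at hε
  exact (smul_eq_zero_iff_left hε0).1 h

/-- Split Z into even and odd parts under conjugation by cᵢ. The even part is central, hence scalar.
The odd part has the same commutation relations as cᵢε, so its product with cᵢε is scalar, and
(cᵢε)² = -1 lets one solve for it. -/
theorem eq_smul_one_add_smul_of_commute_others (hsq : ∀ i, c i * c i = 1)
    (hanti : ∀ i j, i ≠ j → c i * c j = -(c j * c i))
    (hcent : ∀ X, (∀ i, X * c i = c i * X) → ∃ r : ℝ, X = r • 1)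
    (hε : ε * ε = 1) (hcε : ∀ i, c i * ε = -(ε * c i)) {i : ι} {Z : A}
    (hZ : ∀ j, j ≠ i → Z * c j = c j * Z) :
    ∃ α β : ℝ, Z = α • 1 + β • (c i * ε) := by
  have hsq' : ∀ j z, c j * (c j * z) = z := fun j z => by rw [← mul_assoc, hsq, one_mul]
  have hεc : ∀ j, ε * c j = -(c j * ε) := fun j => by rw [hcε, neg_neg]
  have hεc' : ∀ j z, ε * (c j * z) = -(c j * (ε * z)) := fun j z => by
    rw [← mul_assoc, hεc, neg_mul, mul_assoc]
  obtain ⟨α, hα⟩ := hcent (Z + c i * (Z * c i)) fun j => by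
    obtain rfl | hj := eq_or_ne j i
    · simp only [add_mul, mul_add, mul_assoc, hsq, hsq', mul_one]
      abel
    · have hZ' : ∀ z, Z * (c j * z) = c j * (Z * z) := fun z => by
        rw [← mul_assoc, hZ j hj, mul_assoc]
      have hij' : ∀ z, c i * (c j * z) = -(c j * (c i * z)) := fun z => by
        rw [← mul_assoc, hanti i j hj.symm, neg_mul, mul_assoc]
      simp only [add_mul, mul_add, mul_assoc, hZ j hj, hZ', hanti i j hj.symm, hij', mul_neg,
        neg_neg]
  obtain ⟨β, hβ⟩ := hcent ((Z - c i * (Z * c i)) * (c i * ε)) fun j => by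
    obtain rfl | hj := eq_or_ne j i
    · simp only [sub_mul, mul_sub, mul_assoc, hsq', hεc, mul_neg]
      abel
    · have hZ' : ∀ z, Z * (c j * z) = c j * (Z * z) := fun z => by
        rw [← mul_assoc, hZ j hj, mul_assoc]
      have hij' : ∀ z, c i * (c j * z) = -(c j * (c i * z)) := fun z => by
        rw [← mul_assoc, hanti i j hj.symm, neg_mul, mul_assoc]
      simp only [sub_mul, mul_sub, mul_assoc, hεc j, hsq', hZ', hij', mul_neg, neg_neg]
  refine ⟨α / 2, -(β / 2), ?_⟩
  have hβ' : Z - c i * (Z * c i) = -(β • (c i * ε)) := by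
    have := congrArg (· * (c i * ε)) hβ
    have hu : c i * ε * (c i * ε) = -1 := by
      simp only [mul_assoc, hεc', mul_neg, hsq', hε]
    simp only [mul_assoc _ (c i * ε) (c i * ε), hu, mul_neg, mul_one, smul_mul_assoc,
      one_mul] at this
    rw [← this, neg_neg]
  have : Z = (1 / 2 : ℝ) • ((Z + c i * (Z * c i)) + (Z - c i * (Z * c i))) := by module
  rw [hα, hβ'] at this
  rw [this]
  module

/-- Commuting with every cⱼcᵢ makes all conjugates cⱼXcⱼ equal to one X'. Then X + X' is central,
and X - X' anticommutes with every cⱼ, as ε does, so (X - X')ε is central. -/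
theorem eq_smul_one_add_smul_of_commute_even (hsq : ∀ i, c i * c i = 1)
    (hcent : ∀ X, (∀ i, X * c i = c i * X) → ∃ r : ℝ, X = r • 1)
    (hε : ε * ε = 1) (hcε : ∀ i, c i * ε = -(ε * c i)) (i : ι) {X : A}
    (hX : ∀ j, j ≠ i → c j * c i * X = X * (c j * c i)) :
    ∃ α β : ℝ, X = α • 1 + β • ε := by
  have hsq' : ∀ j z, c j * (c j * z) = z := fun j z => by rw [← mul_assoc, hsq, one_mul]
  have hεc : ∀ j, ε * c j = -(c j * ε) := fun j => by rw [hcε, neg_neg]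
  have hconj : ∀ j, c i * (X * c i) = c j * (X * c j) := fun j => by
    obtain rfl | hj := eq_or_ne j i
    · rfl
    · have := congrArg (fun z => c j * (z * c i)) (hX j hj)
      simpa only [mul_assoc, hsq, hsq', mul_one] using this
  obtain ⟨α, hα⟩ := hcent (X + c i * (X * c i)) fun j => by
    rw [hconj j]
    simp only [add_mul, mul_add, mul_assoc, hsq, hsq', mul_one]
    abel
  obtain ⟨β, hβ⟩ := hcent ((X - c i * (X * c i)) * ε) fun j => by
    rw [hconj j]
    simp only [sub_mul, mul_sub, mul_assoc, hsq', hεc, mul_neg]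
    abel
  refine ⟨α / 2, β / 2, ?_⟩
  have hβ' : X - c i * (X * c i) = β • ε := by
    have := congrArg (· * ε) hβ
    simpa only [mul_assoc _ ε ε, hε, mul_one, smul_mul_assoc, one_mul] using this
  have : X = (1 / 2 : ℝ) • ((X + c i * (X * c i)) + (X - c i * (X * c i))) := by module
  rw [hα, hβ'] at this
  rw [this]
  module

/-- The equations `c_j Y_i - X_i c_j = δ_{ij} K` together with the commutativity of the `X_i`
determine `X`, `Y` and `K` up to scalars. -/
theorem diagonal_blocks_of_intertwining [Nontrivial A] [Nontrivial ι] (hsq : ∀ i, c i * c i = 1)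
    (hanti : ∀ i j, i ≠ j → c i * c j = -(c j * c i))
    (hcent : ∀ X, (∀ i, X * c i = c i * X) → ∃ r : ℝ, X = r • 1)
    (hε : ε * ε = 1) (hcε : ∀ i, c i * ε = -(ε * c i)) {X Y : ι → A} {K : A} (hK : K ≠ 0)
    (hdiag : ∀ i, c i * Y i - X i * c i = K)
    (hoff : ∀ i j, j ≠ i → c j * Y i = X i * c j) (hcomm : ∀ i j, X i * X j = X j * X i) :
    ∃ (s h₁ : ℝ) (h₃ : ι → ℝ), (s = 1 ∨ s = -1) ∧ h₁ ≠ 0 ∧ K = h₁ • (1 + s • ε) ∧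
      ∀ i, X i = (1 / 2 : ℝ) • (h₃ i • 1 + (-h₁) • c i + (s * h₁) • (c i * ε)) ∧
        Y i = (1 / 2 : ℝ) • (h₃ i • 1 + h₁ • c i + (s * h₁) • (c i * ε)) := by
  have hsq' : ∀ j z, c j * (c j * z) = z := fun j z => by rw [← mul_assoc, hsq, one_mul]
  have hεc : ∀ j, ε * c j = -(c j * ε) := fun j => by rw [hcε, neg_neg]
  have hεc' : ∀ j z, ε * (c j * z) = -(c j * (ε * z)) := fun j z => by
    rw [← mul_assoc, hεc, neg_mul, mul_assoc]
  have hoff' : ∀ i j, j ≠ i → c j * X i = Y i * c j := fun i j hj => by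
    have := congrArg (fun z => c j * (z * c j)) (hoff i j hj)
    simpa only [mul_assoc, hsq, hsq', mul_one] using this.symm
  -- For j ≠ i, cⱼ exchanges Xᵢ and Yᵢ under conjugation. Thus it commutes with their sum and
  -- anticommutes with their difference; a factor ε turns the latter into commutation.
  have hsum : ∀ i, ∃ α β : ℝ, X i + Y i = α • 1 + β • (c i * ε) := fun i =>
    eq_smul_one_add_smul_of_commute_others hsq hanti hcent hε hcε fun j hj => by
      rw [add_mul, mul_add, hoff i j hj, hoff' i j hj, add_comm]
  have hdiff : ∀ i, ∃ γ δ : ℝ, X i - Y i = γ • ε + δ • c i := fun i => by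
    obtain ⟨γ, δ, h⟩ := eq_smul_one_add_smul_of_commute_others hsq hanti hcent hε hcε
      (i := i) (Z := (X i - Y i) * ε) fun j hj => by
        rw [mul_assoc, hεc, mul_neg, ← mul_assoc, sub_mul, ← hoff i j hj, ← hoff' i j hj]
        simp only [sub_mul, mul_sub, mul_assoc]
        abel
    refine ⟨γ, δ, ?_⟩
    have := congrArg (· * ε) h
    simpa only [mul_assoc, hε, mul_one, add_mul, smul_mul_assoc, one_mul] using this
  choose α β hsum using hsum
  choose γ δ hdiff using hdiff
  have hX : ∀ i, X i = (1 / 2 : ℝ) •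
      ((α i • 1 + β i • (c i * ε)) + (γ i • ε + δ i • c i)) := fun i => by
    rw [← hsum, ← hdiff]; module
  have hY : ∀ i, Y i = (1 / 2 : ℝ) •
      ((α i • 1 + β i • (c i * ε)) - (γ i • ε + δ i • c i)) := fun i => by
    rw [← hsum, ← hdiff]; module
  have hKi : ∀ i, K = (-δ i) • 1 + β i • ε := fun i => by
    rw [← hdiag i, hX, hY]
    simp only [mul_smul_comm, smul_mul_assoc, mul_add, add_mul, mul_sub, mul_one, one_mul,
      mul_assoc, hsq, hsq', hεc, mul_neg, smul_neg]
    module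
  obtain ⟨i₀, j₀, hij₀⟩ := exists_pair_ne ι
  have hconst : ∀ i, δ i = δ i₀ ∧ β i = β i₀ := fun i => by
    have h : (δ i₀ - δ i) • (1 : A) + (β i - β i₀) • ε = 0 := by
      have := (hKi i).symm.trans (hKi i₀)
      rw [← sub_eq_zero] at this
      rw [← this]; module
    have := smul_one_add_smul_eq_zero (hsq i₀) hε (hcε i₀) h
    exact ⟨(sub_eq_zero.1 this.1).symm, sub_eq_zero.1 this.2⟩
  obtain ⟨d, hd⟩ : ∃ d, d = δ i₀ := ⟨_, rfl⟩
  obtain ⟨t, ht⟩ : ∃ t, t = β i₀ := ⟨_, rfl⟩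
  have hδ : ∀ i, δ i = d := fun i => by rw [hd, (hconst i).1]
  have hβ : ∀ i, β i = t := fun i => by rw [ht, (hconst i).2]
  simp only [hδ, hβ] at hX hY hKi
  have hpair : ∀ i j, i ≠ j → d ^ 2 = t ^ 2 ∧ γ i = 0 := fun i j hij => by
    have hji : c j * c i = -(c i * c j) := by rw [hanti i j hij, neg_neg]
    have hji' : ∀ z, c j * (c i * z) = -(c i * (c j * z)) := fun z => by
      rw [← mul_assoc, hji, neg_mul, mul_assoc]
    -- This is the commutator of Xᵢ and Xⱼ, up to a factor. Conjugation by ε separates the term in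
    -- cᵢcⱼ from the rest, so each vanishes.
    have key : (d ^ 2 - t ^ 2) • (c i * c j) -
        (γ i • c j - γ j • c i) * (t • 1 + d • ε) = 0 := by
      have h := hcomm i j
      rw [hX i, hX j, ← sub_eq_zero] at h
      have h2 := congrArg ((2 : ℝ) • ·) h
      simp only [smul_zero] at h2
      rw [← h2]
      simp only [mul_smul_comm, smul_mul_assoc, mul_add, add_mul, sub_mul, mul_one,
        one_mul, mul_assoc, hεc, hεc', hε, hji, hji', mul_neg, smul_neg]
      module
    have key' : (d ^ 2 - t ^ 2) • (c i * c j) +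
        (γ i • c j - γ j • c i) * (t • 1 + d • ε) = 0 := by
      have h := congrArg (fun z => ε * (z * ε)) key
      simp only [zero_mul, mul_zero] at h
      rw [← h]
      simp only [mul_smul_comm, smul_mul_assoc, mul_add, add_mul, mul_sub, sub_mul, mul_one,
        mul_assoc, hεc, hεc', hε, mul_neg, smul_neg]
      module
    have heven : (d ^ 2 - t ^ 2) • (c i * c j) = 0 := by
      have : (2 : ℝ) • ((d ^ 2 - t ^ 2) • (c i * c j)) = 0 := by
        rw [← add_zero (0 : A)]
        nth_rw 1 [← key]
        rw [← key']
        module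
      exact (smul_eq_zero_iff_right two_ne_zero).1 this
    have hodd : (γ i • c j - γ j • c i) * (t • 1 + d • ε) = 0 := by
      rwa [heven, zero_add] at key'
    constructor
    · have hne : c i * c j ≠ 0 := fun h => by
        have := congrArg (fun z => c i * (z * c j)) h
        simp only [mul_assoc, hsq, mul_one, zero_mul, mul_zero] at this
        exact one_ne_zero this
      exact sub_eq_zero.1 ((smul_eq_zero_iff_left hne).1 heven)
    · have h := congrArg ((γ i • c j - γ j • c i) * ·) hodd
      -- A vector squares to its squared length, while t + dε ≠ 0 because K = -d + tε ≠ 0. So the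
      -- vector, and with it γᵢ, must vanish.
      have hvv : (γ i • c j - γ j • c i) * (γ i • c j - γ j • c i) =
          (γ i ^ 2 + γ j ^ 2) • (1 : A) := by
        simp only [mul_smul_comm, smul_mul_assoc, mul_sub, sub_mul, hsq, hji, smul_neg]
        module
      simp only [← mul_assoc, hvv, mul_zero, smul_mul_assoc, one_mul] at h
      have hne : t • 1 + d • ε ≠ 0 := fun h0 => by
        have := smul_one_add_smul_eq_zero (hsq i₀) hε (hcε i₀) h0
        apply hK
        rw [hKi i₀, this.1, this.2]
        simp
      have h0 := (smul_eq_zero_iff_left hne).1 h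
      exact pow_eq_zero_iff two_ne_zero |>.1 (by nlinarith [sq_nonneg (γ i), sq_nonneg (γ j)])
  have hγ : ∀ i, γ i = 0 := fun i => by
    obtain ⟨j, hj⟩ := exists_ne i
    exact (hpair i j hj.symm).2
  have hdt := (hpair i₀ j₀ hij₀).1
  have hd0 : d ≠ 0 := fun h0 => by
    apply hK
    have ht0 : t = 0 := by
      rw [h0] at hdt
      exact pow_eq_zero_iff two_ne_zero |>.1 (by linarith)
    rw [hKi i₀, h0, ht0]
    simp
  -- The values are read off from K = -d + tε = h₁(1 + sε); s = ±1 because d² = t².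
  refine ⟨-(t / d), -d, α, ?_, neg_ne_zero.2 hd0, ?_, fun i => ⟨?_, ?_⟩⟩
  · have : t / d * (t / d) = 1 := by
      rw [← sq, div_pow, ← hdt, div_self (pow_ne_zero 2 hd0)]
    rcases mul_self_eq_one_iff.1 this with h | h
    · right; rw [h]
    · left; rw [h, neg_neg]
  · have : -d * -(t / d) = t := by field_simp
    rw [hKi i₀, smul_add, smul_smul, this]
  · have : -(t / d) * -d = t := by field_simp
    rw [hX, this, hγ]
    module
  · have : -(t / d) * -d = t := by field_simp
    rw [hY, this, hγ]
    module

end Centralizers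

/-! ### Signs for products of anticommuting square roots of 1 -/

section VolumeElement

variable {A : Type*} [Ring A]

theorem prod_mul_eq_of_anticommute {a : A} {l : List A} (h : ∀ x ∈ l, a * x = -(x * a)) :
    l.prod * a = (-1) ^ l.length * (a * l.prod) := by
  induction l with
  | nil => simp
  | cons x l ih =>
    simp only [List.mem_cons, forall_eq_or_imp] at h
    have hx : x * a = -(a * x) := by rw [h.1, neg_neg]
    have hp : x * (-1) ^ l.length = (-1) ^ l.length * x :=
      ((Commute.neg_one_right x).pow_right _).eq
    rw [List.prod_cons, mul_assoc, ih h.2, ← mul_assoc, hp, mul_assoc, ← mul_assoc x, hx,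
      List.length_cons, pow_succ]
    simp only [mul_assoc, neg_mul, one_mul, mul_neg]

theorem mul_prod_eq_of_mem {l : List A} (hsq : ∀ x ∈ l, x * x = 1)
    (hanti : l.Pairwise fun x y => x * y = -(y * x)) {x : A} (hx : x ∈ l) :
    l.prod * x = -((-1) ^ l.length * (x * l.prod)) := by
  induction l with
  | nil => simp at hx
  | cons a l ih =>
    rw [List.pairwise_cons] at hanti
    have hp : ∀ y : A, y * (-1) ^ l.length = (-1) ^ l.length * y := fun y =>
      ((Commute.neg_one_right y).pow_right _).eq
    rcases List.mem_cons.1 hx with rfl | hx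
    · rw [List.prod_cons, mul_assoc, prod_mul_eq_of_anticommute hanti.1, ← mul_assoc x, hp,
        List.length_cons, pow_succ]
      simp only [mul_assoc, neg_mul, one_mul, mul_neg, neg_neg]
    · have hax := hanti.1 x hx
      have hxa : x * a = -(a * x) := by rw [hax, neg_neg]
      rw [List.prod_cons, mul_assoc,
        ih (fun y hy => hsq y (List.mem_cons_of_mem _ hy)) hanti.2 hx, mul_neg, ← mul_assoc a, hp,
        List.length_cons, pow_succ, ← mul_assoc x, hxa]
      simp only [mul_assoc, neg_mul, one_mul, mul_neg, neg_neg]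

theorem prod_mul_prod_of_anticommute {l : List A} (hsq : ∀ x ∈ l, x * x = 1)
    (hanti : l.Pairwise fun x y => x * y = -(y * x)) :
    l.prod * l.prod = (-1) ^ (l.length.choose 2) := by
  induction l with
  | nil => simp
  | cons a l ih =>
    rw [List.pairwise_cons] at hanti
    have hp : a * (-1) ^ l.length = (-1) ^ l.length * a :=
      ((Commute.neg_one_right a).pow_right _).eq
    rw [List.prod_cons, mul_assoc, ← mul_assoc l.prod, prod_mul_eq_of_anticommute hanti.1,
      mul_assoc, mul_assoc a, ← mul_assoc a, hp, mul_assoc, ← mul_assoc a, hsq a (by simp), one_mul,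
      ih (fun y hy => hsq y (List.mem_cons_of_mem _ hy)) hanti.2, List.length_cons,
      Nat.choose_succ_succ', Nat.choose_one_right, pow_add]

end VolumeElement

/-! ### Real type of S₀, the volume element and the Schur algebra -/

section CliffordModule

variable {E : Type*} [NormedAddCommGroup E] [InnerProductSpace ℝ E]
variable {S₀ : Type*} [AddCommGroup S₀] [Module ℝ S₀] [Module (ClE E) S₀]
  [IsScalarTower ℝ (ClE E) S₀]

variable (S₀) in
theorem vec_mul_vec_add_swap (v w : E) :
    vec S₀ v * vec S₀ w + vec S₀ w * vec S₀ v = (2 * inner ℝ v w : ℝ) • 1 := by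
  have sq : ∀ u : E, vec S₀ u * vec S₀ u = (inner ℝ u u : ℝ) • 1 := fun u =>
    LinearMap.ext (vec_vec u)
  have h := sq (v + w)
  rw [map_add, add_mul, mul_add, mul_add, sq v, sq w, inner_add_left, inner_add_right,
    inner_add_right, real_inner_comm v w] at h
  have e : vec S₀ v * vec S₀ w + vec S₀ w * vec S₀ v =
      (inner ℝ v v • 1 + vec S₀ v * vec S₀ w + (vec S₀ w * vec S₀ v + inner ℝ w w • 1)) -
        ((inner ℝ v v : ℝ) • 1 + (inner ℝ w w : ℝ) • 1) := by abel
  rw [e, h]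
  module

variable (S₀) in
theorem vec_basis_mul_self {ι : Type*} [Fintype ι] (e : OrthonormalBasis ι ℝ E) (i : ι) :
    vec S₀ (e i) * vec S₀ (e i) = 1 := by
  have h : vec S₀ (e i) * vec S₀ (e i) = (inner ℝ (e i) (e i) : ℝ) • 1 :=
    LinearMap.ext (vec_vec (e i))
  rw [h, real_inner_self_eq_norm_sq, e.norm_eq_one, one_pow, one_smul]

variable (S₀) in
theorem vec_basis_anticommute {ι : Type*} [Fintype ι] (e : OrthonormalBasis ι ℝ E) (i j : ι)
    (hij : i ≠ j) : vec S₀ (e i) * vec S₀ (e j) = -(vec S₀ (e j) * vec S₀ (e i)) := by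
  rw [eq_neg_iff_add_eq_zero, vec_mul_vec_add_swap, e.inner_eq_zero hij, mul_zero, zero_smul]

theorem commute_cliff_of_commute_basis {ι : Type*} [Fintype ι] (e : OrthonormalBasis ι ℝ E)
    {X : Module.End ℝ S₀} (hX : ∀ i, X * vec S₀ (e i) = vec S₀ (e i) * X) (a : ClE E) :
    X * cliff S₀ a = cliff S₀ a * X := by
  have hv : LinearMap.mulLeft ℝ X ∘ₗ vec S₀ = LinearMap.mulRight ℝ X ∘ₗ vec S₀ :=
    e.toBasis.ext fun i => by simpa using hX i
  induction a using CliffordAlgebra.induction with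
  | algebraMap r => rw [AlgHom.commutes, Algebra.commutes]
  | ι v => exact LinearMap.congr_fun hv v
  | mul a b ha hb => rw [map_mul, ← mul_assoc, ha, mul_assoc, hb, mul_assoc]
  | add a b ha hb => rw [map_add, mul_add, add_mul, ha, hb]

theorem cliff_mem_adjoin {ι : Type*} [Fintype ι] (e : OrthonormalBasis ι ℝ E)
    {B : Subalgebra ℝ (Module.End ℝ S₀)} (hB : ∀ i, vec S₀ (e i) ∈ B) (a : ClE E) :
    cliff S₀ a ∈ B := by
  induction a using CliffordAlgebra.induction with
  | algebraMap r => rw [AlgHom.commutes]; exact B.algebraMap_mem r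
  | ι v =>
    change vec S₀ v ∈ B
    rw [← e.sum_repr v, map_sum]
    exact sum_mem fun i _ => by rw [map_smul]; exact B.smul_mem (hB i) _
  | mul a b ha hb => rw [map_mul]; exact mul_mem ha hb
  | add a b ha hb => rw [map_add]; exact add_mem ha hb

variable (S₀) in
theorem isCliffordSystem_ofFn {m : ℕ} (e : OrthonormalBasis (Fin m) ℝ E) :
    IsCliffordSystem (List.ofFn fun i => vec S₀ (e i)) (List.replicate m 1) where
  sq := by
    rw [List.forall₂_iff_get]
    refine ⟨by simp, fun i h₁ h₂ => ?_⟩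
    simp [vec_basis_mul_self]
  anti := by
    rw [List.pairwise_ofFn]
    exact fun i j hij => vec_basis_anticommute S₀ e i j hij.ne

/-- Irreducible modules over positive definite Clifford algebras of dimension divisible by eight
are of real type. -/
theorem eq_smul_one_of_commute_basis [IsSimpleModule (ClE E) S₀] {m : ℕ} (hm : 8 ∣ m)
    (e : OrthonormalBasis (Fin m) ℝ E) {X : Module.End ℝ S₀}
    (hX : ∀ i, X * vec S₀ (e i) = vec S₀ (e i) * X) : ∃ r : ℝ, X = r • 1 := by
  have : Nontrivial S₀ := IsSimpleModule.nontrivial (ClE E) S₀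
  obtain ⟨k, rfl⟩ := hm
  obtain ⟨P, hPB, hP0, hPP, hP⟩ :=
    isSplitSignature_replicate (Module.End ℝ S₀) k _ (isCliffordSystem_ofFn S₀ e)
  have hmem := fun a => cliff_mem_adjoin (B := Algebra.adjoin ℝ
    {x | x ∈ List.ofFn fun i => vec S₀ (e i)}) e
    (fun i => Algebra.subset_adjoin (List.mem_ofFn.2 ⟨i, rfl⟩)) a
  have hXP : X * P = P * X := by
    have : P ∈ Subalgebra.centralizer ℝ {X} := by
      refine Algebra.adjoin_le ?_ hPB
      intro x hx
      obtain ⟨i, rfl⟩ := List.mem_ofFn.1 hx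
      rw [SetLike.mem_coe, Subalgebra.mem_centralizer_iff]
      intro Y hY
      rw [Set.mem_singleton_iff.1 hY, hX]
    exact Subalgebra.mem_centralizer_iff ℝ |>.1 this X rfl
  obtain ⟨y, hy⟩ : ∃ y, P y ≠ 0 := by
    by_contra! h
    exact hP0 (LinearMap.ext h)
  have hgen : ∀ z : S₀, ∃ a : ClE E, cliff S₀ a (P y) = z := fun z => by
    have : z ∈ Submodule.span (ClE E) {P y} := by
      rw [IsSimpleModule.span_singleton_eq_top (ClE E) hy]; trivial
    obtain ⟨a, ha⟩ := Submodule.mem_span_singleton.1 this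
    exact ⟨a, ha⟩
  -- Writing X(Py) = a·Py and using XP = PX gives X(Py) = PaPy, a multiple of Py by primitivity of
  -- P.
  obtain ⟨a, ha⟩ := hgen (X (P y))
  obtain ⟨r, hr⟩ := hP (cliff S₀ a) (hmem a)
  have happ : ∀ {S T : Module.End ℝ S₀}, S = T → ∀ z, S z = T z := fun h z => by rw [h]
  have hXr : X (P y) = r • P y := by
    have h1 : X (P y) = P (X (P y)) := by
      have := happ hXP (P y)
      simp only [Module.End.mul_apply] at this
      rw [← this]
      exact congrArg X (happ hPP y).symm
    rw [h1, ← ha]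
    exact happ hr y
  refine ⟨r, LinearMap.ext fun z => ?_⟩
  obtain ⟨a, rfl⟩ := hgen z
  have := happ (commute_cliff_of_commute_basis e hX a) (P y)
  simp only [Module.End.mul_apply] at this
  rw [this, hXr]
  simp

variable (S₀) in
theorem cliff_volumeElement {m : ℕ} (e : OrthonormalBasis (Fin m) ℝ E) :
    cliff S₀ (volumeElement e) = (List.ofFn fun i => vec S₀ (e i)).prod := by
  rw [volumeElement, map_list_prod, List.map_ofFn]
  rfl

variable (S₀) in
theorem cliff_volumeElement_mul_self {m : ℕ} (hm : 8 ∣ m) (e : OrthonormalBasis (Fin m) ℝ E) :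
    cliff S₀ (volumeElement e) * cliff S₀ (volumeElement e) = 1 := by
  rw [cliff_volumeElement, prod_mul_prod_of_anticommute ?_ (isCliffordSystem_ofFn S₀ e).anti,
    List.length_ofFn]
  · apply Even.neg_one_pow
    obtain ⟨k, rfl⟩ := hm
    rw [Nat.choose_two_right, mul_assoc,
      show 8 * (k * (8 * k - 1)) = 2 * (4 * (k * (8 * k - 1))) by ring,
      Nat.mul_div_cancel_left _ two_pos]
    exact Even.mul_right (by decide) _
  · intro x hx
    obtain ⟨i, rfl⟩ := List.mem_ofFn.1 hx
    exact vec_basis_mul_self S₀ e i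

variable (S₀) in
theorem vec_basis_mul_cliff_volumeElement {m : ℕ} (hm : Even m)
    (e : OrthonormalBasis (Fin m) ℝ E) (i : Fin m) :
    vec S₀ (e i) * cliff S₀ (volumeElement e) =
      -(cliff S₀ (volumeElement e) * vec S₀ (e i)) := by
  rw [cliff_volumeElement, mul_prod_eq_of_mem (x := vec S₀ (e i)) ?_
    (isCliffordSystem_ofFn S₀ e).anti (List.mem_ofFn.2 ⟨i, rfl⟩), List.length_ofFn,
    hm.neg_one_pow, one_mul, neg_neg]
  intro x hx
  obtain ⟨i, rfl⟩ := List.mem_ofFn.1 hx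
  exact vec_basis_mul_self S₀ e i

theorem vec_anticommute_of_basis {ι : Type*} [Fintype ι] (e : OrthonormalBasis ι ℝ E)
    {X : Module.End ℝ S₀} (hX : ∀ i, vec S₀ (e i) * X = -(X * vec S₀ (e i))) (v : E) :
    vec S₀ v * X = -(X * vec S₀ v) := by
  have hv : LinearMap.mulRight ℝ X ∘ₗ vec S₀ = -(LinearMap.mulLeft ℝ X ∘ₗ vec S₀) :=
    e.toBasis.ext fun i => by simpa using hX i
  exact LinearMap.congr_fun hv v

theorem cliff_wedgeE (v w : E) : cliff S₀ (wedgeE v w) =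
    (1 / 4 : ℝ) • (vec S₀ v * vec S₀ w - vec S₀ w * vec S₀ v) := by
  simp only [wedgeE, map_smul, map_sub, map_mul]
  rfl

theorem mem_schurAlgebra_of_anticommute {X : Module.End ℝ S₀}
    (hX : ∀ v : E, vec S₀ v * X = -(X * vec S₀ v)) : X ∈ schurAlgebra E S₀ := by
  rw [schurAlgebra, Subalgebra.mem_centralizer_iff]
  rintro _ ⟨v, w, rfl⟩
  have h2 : ∀ v w : E, vec S₀ v * vec S₀ w * X = X * (vec S₀ v * vec S₀ w) := fun v w => by
    rw [mul_assoc, hX w, mul_neg, ← mul_assoc, hX v, neg_mul, neg_neg, mul_assoc]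
  rw [cliff_wedgeE, smul_mul_assoc, mul_smul_comm, sub_mul, mul_sub, h2, h2]

/-- The involution Y maps each eigenspace of X injectively into the opposite one. -/
theorem isParaComplex_of_anticommute {V : Type*} [AddCommGroup V] [Module ℝ V]
    {X Y : Module.End ℝ V} (hX : X * X = 1) (hY : Y * Y = 1) (h : Y * X = -(X * Y)) :
    IsParaComplex X := by
  refine ⟨hX, ?_⟩
  have key : ∀ r : ℝ, Module.rank ℝ (X.eigenspace r) ≤ Module.rank ℝ (X.eigenspace (-r)) := by
    intro r
    have hmap : ∀ x ∈ X.eigenspace r, Y x ∈ X.eigenspace (-r) := fun x hx => by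
      rw [Module.End.mem_eigenspace_iff] at hx ⊢
      have := LinearMap.congr_fun h x
      simp only [Module.End.mul_apply, LinearMap.neg_apply, hx, map_smul] at this
      rw [neg_smul, this, neg_neg]
    refine LinearMap.rank_le_of_injective (Y.restrict hmap) fun x y hxy => Subtype.ext ?_
    have h1 : Y x = Y y := congrArg Subtype.val hxy
    have hYY : ∀ z, Y (Y z) = z := LinearMap.congr_fun hY
    rw [← hYY x, h1, hYY]
  refine le_antisymm (key 1) ?_
  have := key (-1)
  rwa [neg_neg] at this

theorem not_isParaComplex_smul_one {V : Type*} [AddCommGroup V] [Module ℝ V] [Nontrivial V]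
    (r : ℝ) : ¬ IsParaComplex (r • (1 : Module.End ℝ V)) := by
  rintro ⟨hsq, hrank⟩
  have hr : r * r = 1 := by
    obtain ⟨x, hx⟩ := exists_ne (0 : V)
    have h := LinearMap.congr_fun hsq x
    simp only [Module.End.mul_apply, LinearMap.smul_apply, Module.End.one_apply, smul_smul] at h
    exact smul_left_injective ℝ hx (h.trans (one_smul ℝ x).symm)
  have hr0 : r ≠ 0 := by rintro rfl; simp at hr
  have htop : (r • (1 : Module.End ℝ V)).eigenspace r = ⊤ := by
    rw [eq_top_iff]
    intro x _
    simp
  have hbot : (r • (1 : Module.End ℝ V)).eigenspace (-r) = ⊥ := by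
    rw [eq_bot_iff]
    intro x hx
    rw [Module.End.mem_eigenspace_iff, LinearMap.smul_apply, Module.End.one_apply, neg_smul] at hx
    exact (smul_eq_zero_iff_right hr0).1 (eq_zero_of_eq_neg hx)
  have hrank' : Module.rank ℝ ((r • (1 : Module.End ℝ V)).eigenspace r) =
      Module.rank ℝ ((r • (1 : Module.End ℝ V)).eigenspace (-r)) := by
    rcases mul_self_eq_one_iff.1 hr with rfl | rfl
    · exact hrank
    · rw [neg_neg]; exact hrank.symm
  rw [htop, hbot, rank_top, rank_bot] at hrank'
  exact rank_pos.ne' hrank'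

/-- Elements of the Schur algebra have the form α + βω. Then X² = 1 forces αβ = 0, and β = 0 is
excluded because a scalar has unequal eigenspaces for ±1. So X is a multiple of ω. This is why an
arbitrary para-complex structure may replace the volume element. -/
theorem IsParaComplex.anticommute_of_mem_schurAlgebra [IsSimpleModule (ClE E) S₀] {m : ℕ}
    (hm : 8 ∣ m) (hm0 : m ≠ 0) (e : OrthonormalBasis (Fin m) ℝ E) {X : Module.End ℝ S₀}
    (hX : X ∈ schurAlgebra E S₀) (hpara : IsParaComplex X) (v : E) :
    vec S₀ v * X = -(X * vec S₀ v) := by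
  have : Nontrivial S₀ := IsSimpleModule.nontrivial (ClE E) S₀
  have hsq := vec_basis_mul_self S₀ e
  have hω := cliff_volumeElement_mul_self S₀ hm e
  have hcω := vec_basis_mul_cliff_volumeElement S₀ (even_iff_two_dvd.2 (.trans (by norm_num) hm)) e
  let i₀ : Fin m := ⟨0, Nat.pos_of_ne_zero hm0⟩
  rw [schurAlgebra, Subalgebra.mem_centralizer_iff] at hX
  obtain ⟨α, β, rfl⟩ := eq_smul_one_add_smul_of_commute_even (X := X) hsq
    (fun X hX => eq_smul_one_of_commute_basis hm e hX) hω hcω i₀ fun j hj => by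
      have h := hX _ ⟨e j, e i₀, rfl⟩
      have hji : vec S₀ (e i₀) * vec S₀ (e j) = -(vec S₀ (e j) * vec S₀ (e i₀)) :=
        vec_basis_anticommute S₀ e i₀ j hj.symm
      rw [cliff_wedgeE, hji, sub_neg_eq_add, ← two_smul ℝ, smul_smul, smul_mul_assoc,
        mul_smul_comm] at h
      exact smul_right_injective _ (by norm_num) h
  have hαβ : α = 0 := by
    have h : (α ^ 2 + β ^ 2 - 1) • (1 : Module.End ℝ S₀) +
        (2 * α * β) • cliff S₀ (volumeElement e) = 0 := by
      have := hpara.1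
      rw [← sub_eq_zero] at this
      rw [← this]
      simp only [add_mul, mul_add, smul_mul_assoc, mul_smul_comm, one_mul, mul_one, hω]
      module
    have h0 := (smul_one_add_smul_eq_zero (hsq i₀) hω (hcω i₀) h).2
    by_contra hα
    have hβ : β = 0 := by simpa [hα] using h0
    rw [hβ, zero_smul, add_zero] at hpara
    exact not_isParaComplex_smul_one α hpara
  apply vec_anticommute_of_basis e
  intro i
  rw [hαβ, zero_smul, zero_add, mul_smul_comm, smul_mul_assoc, hcω, smul_neg]

end CliffordModule

/-! ### Calculus of 2×2 block endomorphisms -/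

section Blocks

variable {V : Type*} [AddCommGroup V] [Module ℝ V]

theorem block_mul (a b c d a' b' c' d' : Module.End ℝ V) :
    block a b c d * block a' b' c' d' =
      block (a * a' + b * c') (a * b' + b * d') (c * a' + d * c') (c * b' + d * d') := by
  refine LinearMap.ext fun x => Prod.ext ?_ ?_ <;> simp [block] <;> abel

theorem block_sub (a b c d a' b' c' d' : Module.End ℝ V) :
    block a b c d - block a' b' c' d' = block (a - a') (b - b') (c - c') (d - d') := by
  refine LinearMap.ext fun x => Prod.ext ?_ ?_ <;> simp [block] <;> abel

theorem block_add (a b c d a' b' c' d' : Module.End ℝ V) :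
    block a b c d + block a' b' c' d' = block (a + a') (b + b') (c + c') (d + d') := by
  refine LinearMap.ext fun x => Prod.ext ?_ ?_ <;> simp [block] <;> abel

theorem smul_block (r : ℝ) (a b c d : Module.End ℝ V) :
    r • block a b c d = block (r • a) (r • b) (r • c) (r • d) := by
  refine LinearMap.ext fun x => Prod.ext ?_ ?_ <;> simp [block]

theorem block_zero : block (0 : Module.End ℝ V) 0 0 0 = 0 := by
  refine LinearMap.ext fun x => Prod.ext ?_ ?_ <;> simp [block]

theorem block_inj {a b c d a' b' c' d' : Module.End ℝ V} :
    block a b c d = block a' b' c' d' ↔ a = a' ∧ b = b' ∧ c = c' ∧ d = d' := by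
  refine ⟨fun h => ?_, by rintro ⟨rfl, rfl, rfl, rfl⟩; rfl⟩
  have h₁ : ∀ x, block a b c d (x, 0) = block a' b' c' d' (x, 0) := fun x => by rw [h]
  have h₂ : ∀ x, block a b c d (0, x) = block a' b' c' d' (0, x) := fun x => by rw [h]
  simp only [block, LinearMap.prod_apply, Function.prod_apply, LinearMap.coprod_apply, map_zero,
    add_zero, zero_add, Prod.mk.injEq] at h₁ h₂
  exact ⟨LinearMap.ext fun x => (h₁ x).1, LinearMap.ext fun x => (h₂ x).1,
    LinearMap.ext fun x => (h₁ x).2, LinearMap.ext fun x => (h₂ x).2⟩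

/-- A linear family of endomorphisms of `V × V` splits into four linear families of blocks. -/
theorem exists_eq_block {W : Type*} [AddCommGroup W] [Module ℝ W]
    (T : W →ₗ[ℝ] Module.End ℝ (V × V)) :
    ∃ a b c d : W →ₗ[ℝ] Module.End ℝ V, ∀ w, T w = block (a w) (b w) (c w) (d w) := by
  let pick (f : V × V →ₗ[ℝ] V) (g : V →ₗ[ℝ] V × V) : W →ₗ[ℝ] Module.End ℝ V :=
    { toFun := fun w => f ∘ₗ T w ∘ₗ g
      map_add' := fun v w => by ext; simp
      map_smul' := fun r w => by ext; simp }
  refine ⟨pick (LinearMap.fst ℝ V V) (LinearMap.inl ℝ V V),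
    pick (LinearMap.fst ℝ V V) (LinearMap.inr ℝ V V),
    pick (LinearMap.snd ℝ V V) (LinearMap.inl ℝ V V),
    pick (LinearMap.snd ℝ V V) (LinearMap.inr ℝ V V), fun w => LinearMap.ext fun x => ?_⟩
  have hx : T w x = T w (x.1, 0) + T w (0, x.2) := by
    rw [← map_add, Prod.mk_add_mk, add_zero, zero_add]
  rw [hx]
  rfl

end Blocks

/-! ### The endomorphism B and the brackets of the Heisenberg algebra -/

section Heisenberg

variable {E : Type*} [NormedAddCommGroup E] [InnerProductSpace ℝ E]

theorem Heis.ofDual_apply (b : LinearMap.BilinForm ℝ E) (α : Module.Dual ℝ E) :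
    Heis.ofDual b α = ((α, 0, 0) : Module.Dual ℝ E × E × ℝ) := rfl

theorem Heis.ofE_apply (b : LinearMap.BilinForm ℝ E) (v : E) :
    Heis.ofE b v = ((0, v, 0) : Module.Dual ℝ E × E × ℝ) := rfl

variable [FiniteDimensional ℝ E]

theorem inner_opB (b : LinearMap.BilinForm ℝ E) (v w : E) : inner ℝ (opB b v) w = b v w := by
  have h : flat (opB b v) = -b v := by simp [opB]
  have h' : flat (opB b v) w = -(inner ℝ (opB b v) w : ℝ) := by
    simp [flat, LinearMap.BilinForm.toDual_def, scalarE_apply]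
  rw [h, LinearMap.neg_apply, neg_inj] at h'
  exact h'.symm

theorem opB_surjective {b : LinearMap.BilinForm ℝ E} (hb : b.Nondegenerate) :
    Function.Surjective (opB b) := by
  rw [← LinearMap.injective_iff_surjective, injective_iff_map_eq_zero]
  intro v hv
  exact hb.1 v fun w => by rw [← inner_opB, hv, inner_zero_left]

variable (b : LinearMap.BilinForm ℝ E)

theorem Heis.lie_ofDual_ofE (v w : E) :
    ⁅Heis.ofDual b (flat v), Heis.ofE b w⁆ = b v w • Heis.p b := by
  change (b (flat.symm (flat v)) w - b (flat.symm 0) 0) • Heis.p b = _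
  simp

theorem Heis.lie_ofE_ofE (v w : E) : ⁅Heis.ofE b v, Heis.ofE b w⁆ = 0 := by
  change (b (flat.symm 0) w - b (flat.symm 0) v) • Heis.p b = _
  simp

theorem Heis.eq_add_add (x : Heis b) : x =
    Heis.ofDual b (flat (flat.symm x.1)) + Heis.ofE b x.2.1 + x.2.2 • Heis.p b := by
  obtain ⟨α, v, s⟩ := x
  have : ((α, v, s) : Module.Dual ℝ E × E × ℝ) =
      (flat (flat.symm α), 0, 0) + (0, v, 0) + s • (0, 0, 1) := by simp
  exact this

end Heisenberg

/-! ### Classification and construction of the spin representations -/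

section Representations

variable {E : Type*} [NormedAddCommGroup E] [InnerProductSpace ℝ E]
variable {S₀ : Type*} [AddCommGroup S₀] [Module ℝ S₀] [Module (ClE E) S₀]
  [IsScalarTower ℝ (ClE E) S₀]

/-- Since p and u anticommute in the Clifford algebra, ¼(pu - up) = ½pu, whose only block is ½ · 2√2
u. -/
theorem spinRep_wedgeM (u : E) :
    spinRep S₀ (wedgeM (0, 1, 0) (u, 0, 0)) = block 0 (√2 • vec S₀ u) 0 0 := by
  have hι : ∀ v : Minkowski E, spinRep S₀ (ιM v) = vecM S₀ v := fun v => by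
    simp [spinRep, CliffordAlgebra.lift_ι_apply]
  rw [wedgeM, map_smul, map_sub, map_mul, map_mul, hι, hι]
  simp only [vecM, LinearMap.coe_mk, AddHom.coe_mk, block_mul, block_sub, smul_block, block_inj]
  simp only [map_zero, neg_zero, mul_zero, mul_one, zero_smul, zero_div, zero_mul, add_zero,
    zero_add, sub_zero, smul_zero, smul_mul_assoc, one_mul, mul_smul_comm, mul_neg,
    true_and, and_true]
  module

theorem diagBlock_apply (X : Module.End ℝ S₀) (c s : ℝ) (h₃ : Module.Dual ℝ E) (v : E) :
    diagBlock X c s h₃ v = (1 / 2 : ℝ) • (h₃ v • 1 + c • vec S₀ v + s • (vec S₀ v * X)) := rfl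

variable [FiniteDimensional ℝ E] {b : LinearMap.BilinForm ℝ E}

theorem IsSpin.exists_eq_block [IsSimpleModule (ClE E) S₀] {m : ℕ} (hm : 8 ∣ m) (hm0 : m ≠ 0)
    (e : OrthonormalBasis (Fin m) ℝ E) (hb : b.Nondegenerate) {X : Module.End ℝ S₀}
    (hXX : X * X = 1) (hX : ∀ v : E, vec S₀ v * X = -(X * vec S₀ v))
    {ρ : Heis b →ₗ⁅ℝ⁆ Module.End ℝ (S₀ × S₀)} (hρ : IsSpin ρ) (hp : ρ (Heis.p b) ≠ 0) :
    ∃ (s h₁ : ℝ) (h₃ : Module.Dual ℝ E) (ρ₁₂ : E →ₗ[ℝ] Module.End ℝ S₀),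
      (s = 1 ∨ s = -1) ∧ h₁ ≠ 0 ∧
      IsSuitable (diagBlock X (-h₁) (s * h₁) h₃) (diagBlock X h₁ (s * h₁) h₃) ρ₁₂ ∧
      ρ (Heis.p b) = √2 • block 0 (h₁ • (1 + s • X)) 0 0 ∧
      ∀ v : E, ρ (Heis.ofE b v) =
        block (diagBlock X (-h₁) (s * h₁) h₃ v) (ρ₁₂ v) 0 (diagBlock X h₁ (s * h₁) h₃ v) := by
  have : Nontrivial S₀ := IsSimpleModule.nontrivial (ClE E) S₀
  have hm2 : 2 ≤ m := le_trans (by norm_num) (Nat.le_of_dvd (Nat.pos_of_ne_zero hm0) hm)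
  have : Nontrivial (Fin m) := Fin.nontrivial_iff_two_le.2 hm2
  have hsqrt : (√2 : ℝ) ≠ 0 := by positivity
  obtain ⟨A, C, D, F, hblock⟩ :=
    CahenWallach.exists_eq_block
      ((ρ : Heis b →ₗ[ℝ] Module.End ℝ (S₀ × S₀)) ∘ₗ Heis.ofE b)
  have hblock : ∀ v, ρ (Heis.ofE b v) = block (A v) (C v) (D v) (F v) := hblock
  -- This is the image of [w^♭, v] = b(w, v)p with u = Bw; surjectivity of B makes u arbitrary and
  -- removes b from the problem.
  have hcharge : ∀ u v : E, (inner ℝ u v : ℝ) • ρ (Heis.p b) =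
      block (√2 • (vec S₀ u * D v)) (√2 • (vec S₀ u * F v - A v * vec S₀ u)) 0
        (-(√2 • (D v * vec S₀ u))) := fun u v => by
    obtain ⟨w, rfl⟩ := opB_surjective hb u
    rw [inner_opB, ← map_smul, ← Heis.lie_ofDual_ofE, LieHom.map_lie, hρ w, spinRep_wedgeM,
      hblock, Ring.lie_def, block_mul, block_mul, block_sub, block_inj]
    simp only [zero_mul, mul_zero, zero_add, add_zero, sub_zero, zero_sub, smul_mul_assoc,
      mul_smul_comm, smul_sub, and_true]
  have hsq := vec_basis_mul_self S₀ e
  -- Testing against a basis vector orthogonal to eᵢ makes the left side zero without knowing ρ(p);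
  -- this needs a second basis vector.
  have hD : D = 0 := e.toBasis.ext fun i => by
    obtain ⟨j, hj⟩ := exists_ne i
    have h := hcharge (e j) (e i)
    rw [e.inner_eq_zero hj, zero_smul, ← block_zero, block_inj] at h
    have h0 : vec S₀ (e j) * D (e i) = 0 := (smul_eq_zero_iff_right hsqrt).1 h.1.symm
    have := congrArg (vec S₀ (e j) * ·) h0
    simpa only [← mul_assoc, hsq, one_mul, mul_zero, OrthonormalBasis.coe_toBasis,
      LinearMap.zero_apply] using this
  have hblock : ∀ v, ρ (Heis.ofE b v) = block (A v) (C v) 0 (F v) := fun v => by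
    rw [hblock, hD, LinearMap.zero_apply]
  simp only [hD, LinearMap.zero_apply, mul_zero, zero_mul, smul_zero, neg_zero] at hcharge
  obtain ⟨i₀⟩ : Nonempty (Fin m) := inferInstance
  obtain ⟨K, hK⟩ : ∃ K, K = vec S₀ (e i₀) * F (e i₀) - A (e i₀) * vec S₀ (e i₀) := ⟨_, rfl⟩
  have hself : ∀ i, (inner ℝ (e i) (e i) : ℝ) = 1 := fun i => by
    rw [real_inner_self_eq_norm_sq, e.norm_eq_one, one_pow]
  have hpK : ρ (Heis.p b) = block 0 (√2 • K) 0 0 := by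
    have := hcharge (e i₀) (e i₀)
    rwa [hself, one_smul, ← hK] at this
  have hK0 : K ≠ 0 := by
    rintro rfl
    rw [smul_zero, block_zero] at hpK
    exact hp hpK
  have hcomm : ∀ u v : E, A u * A v = A v * A u ∧ A u * C v + C u * F v = A v * C u + C v * F u :=
    fun u v => by
      have h := LieHom.map_lie ρ (Heis.ofE b u) (Heis.ofE b v)
      rw [Heis.lie_ofE_ofE, map_zero, hblock, hblock, Ring.lie_def, block_mul, block_mul, eq_comm,
        sub_eq_zero, block_inj] at h
      simp only [mul_zero, add_zero] at h
      exact ⟨h.1, h.2.1⟩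
  obtain ⟨s, h₁, h₃, hs, hh₁, hKs, hAF⟩ := diagonal_blocks_of_intertwining
    (X := fun i => A (e i)) (Y := fun i => F (e i)) hsq (vec_basis_anticommute S₀ e)
    (fun X hX => eq_smul_one_of_commute_basis hm e hX) hXX (fun i => hX (e i)) hK0
    (fun i => by
      have := hcharge (e i) (e i)
      rw [hself, one_smul, hpK, block_inj] at this
      exact (smul_right_injective _ hsqrt this.2.1).symm)
    (fun i j hj => by
      have := hcharge (e j) (e i)
      rw [e.inner_eq_zero hj, zero_smul, ← block_zero, block_inj] at this
      exact sub_eq_zero.1 ((smul_eq_zero_iff_right hsqrt).1 this.2.1.symm))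
    (fun i j => (hcomm (e i) (e j)).1)
  let φ : Module.Dual ℝ E := e.toBasis.constr ℝ h₃
  have hφ : ∀ i, φ (e i) = h₃ i := fun i => by
    have := e.toBasis.constr_basis ℝ h₃ i
    rwa [OrthonormalBasis.coe_toBasis] at this
  have hA : A = diagBlock X (-h₁) (s * h₁) φ := e.toBasis.ext fun i => by
    rw [OrthonormalBasis.coe_toBasis, diagBlock_apply, hφ]
    exact (hAF i).1
  have hF : F = diagBlock X h₁ (s * h₁) φ := e.toBasis.ext fun i => by
    rw [OrthonormalBasis.coe_toBasis, diagBlock_apply, hφ]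
    exact (hAF i).2
  refine ⟨s, h₁, φ, C, hs, hh₁, ?_, ?_, ?_⟩
  · rw [← hA, ← hF]
    intro u v
    rw [sub_eq_sub_iff_add_eq_add]
    exact (hcomm u v).2
  · rw [hpK, hKs, smul_block, smul_zero]
  · rw [← hA, ← hF]
    exact hblock

theorem existsUnique_isSpin {X : Module.End ℝ S₀} (hXX : X * X = 1)
    (hX : ∀ v : E, vec S₀ v * X = -(X * vec S₀ v)) (hX1 : X ≠ 1) (hX2 : X ≠ -1) {s h₁ : ℝ}
    {h₃ : Module.Dual ℝ E} {ρ₁₂ : E →ₗ[ℝ] Module.End ℝ S₀} (hs : s = 1 ∨ s = -1) (hh₁ : h₁ ≠ 0)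
    (hsuit : IsSuitable (diagBlock X (-h₁) (s * h₁) h₃) (diagBlock X h₁ (s * h₁) h₃) ρ₁₂) :
    ∃! ρ : Heis b →ₗ⁅ℝ⁆ Module.End ℝ (S₀ × S₀),
      IsSpin ρ ∧ ρ (Heis.p b) ≠ 0 ∧
      ρ (Heis.p b) = √2 • block 0 (h₁ • (1 + s • X)) 0 0 ∧
      ∀ v : E, ρ (Heis.ofE b v) =
        block (diagBlock X (-h₁) (s * h₁) h₃ v) (ρ₁₂ v) 0 (diagBlock X h₁ (s * h₁) h₃ v) := by
  have hsqrt : (√2 : ℝ) ≠ 0 := by positivity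
  have hXv : ∀ v : E, X * vec S₀ v = -(vec S₀ v * X) := fun v => by rw [hX, neg_neg]
  have hXv' : ∀ (v : E) z, X * (vec S₀ v * z) = -(vec S₀ v * (X * z)) := fun v z => by
    rw [← mul_assoc, hXv, neg_mul, mul_assoc]
  obtain ⟨K, hK⟩ : ∃ K, K = h₁ • (1 + s • X) := ⟨_, rfl⟩
  have hK0 : K ≠ 0 := by
    rw [hK]
    intro h
    have h := (smul_eq_zero_iff_right hh₁).1 h
    rcases hs with rfl | rfl
    · rw [one_smul, add_comm, ← eq_neg_iff_add_eq_zero] at h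
      exact hX2 h
    · rw [neg_smul, one_smul, ← sub_eq_add_neg, sub_eq_zero] at h
      exact hX1 h.symm
  obtain ⟨A, hA⟩ : ∃ A, A = diagBlock X (-h₁) (s * h₁) h₃ := ⟨_, rfl⟩
  obtain ⟨F, hF⟩ : ∃ F, F = diagBlock X h₁ (s * h₁) h₃ := ⟨_, rfl⟩
  -- Up to scalars A(v) is h₃(v) plus a multiple of v(-1 + sX). Products of two such non-scalar
  -- parts vanish: moving X past a vector flips its sign, and (1 + sX)(1 - sX) = 0. The same
  -- cancellation gives `hFF` and `hAK`.
  have hAA : ∀ u v, A u * A v = A v * A u := fun u v => by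
    rcases hs with rfl | rfl <;>
    · simp only [hA, diagBlock_apply, mul_add, add_mul, smul_mul_assoc, mul_smul_comm, one_mul,
        mul_one, mul_assoc, hXv, hXv', hXX, mul_neg, smul_neg]
      module
  have hFF : ∀ u v, F u * F v = F v * F u := fun u v => by
    rcases hs with rfl | rfl <;>
    · simp only [hF, diagBlock_apply, mul_add, add_mul, smul_mul_assoc, mul_smul_comm, one_mul,
        mul_one, mul_assoc, hXv, hXv', hXX, mul_neg, smul_neg]
      module
  have hint : ∀ u v, vec S₀ u * F v - A v * vec S₀ u = (inner ℝ u v : ℝ) • K := fun u v => by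
    have e : (inner ℝ u v : ℝ) • K =
        (h₁ / 2) • ((2 * inner ℝ u v : ℝ) • 1 + s • (((2 * inner ℝ u v : ℝ) • 1) * X)) := by
      rw [hK, smul_mul_assoc, one_mul]; module
    rw [e, ← vec_mul_vec_add_swap]
    simp only [hA, hF, diagBlock_apply, mul_add, add_mul, smul_mul_assoc, mul_smul_comm, one_mul,
      mul_one, mul_assoc, hXv, mul_neg, smul_neg]
    module
  -- Both sides equal ½h₃(v)K; this relation makes the image of p commute with the images of E.
  have hAK : ∀ v, A v * K = K * F v := fun v => by
    rcases hs with rfl | rfl <;>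
    · simp only [hA, hF, hK, diagBlock_apply, mul_add, add_mul, smul_mul_assoc, mul_smul_comm, one_mul,
        mul_one, mul_assoc, hXv, hXv', hXX, smul_neg]
      module
  rw [← hK, ← hA, ← hF]
  rw [← hA, ← hF] at hsuit
  -- The values on E^*, E and p are all prescribed, which also yields uniqueness. The elements of
  -- E^* and p contribute only to the upper right corner.
  let T : Heis b →ₗ[ℝ] Module.End ℝ (S₀ × S₀) :=
    { toFun := fun x => block (A x.2.1)
        (ρ₁₂ x.2.1 + √2 • vec S₀ (opB b (flat.symm x.1)) + x.2.2 • √2 • K) 0 (F x.2.1)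
      map_add' := fun x y => by
        change block (A (x.2.1 + y.2.1)) (ρ₁₂ (x.2.1 + y.2.1) +
          √2 • vec S₀ (opB b (flat.symm (x.1 + y.1))) + (x.2.2 + y.2.2) • √2 • K) 0
          (F (x.2.1 + y.2.1)) = _
        rw [block_add, block_inj]
        simp only [map_add, add_zero, true_and, and_true]
        module
      map_smul' := fun r x => by
        change block (A (r • x.2.1)) (ρ₁₂ (r • x.2.1) +
          √2 • vec S₀ (opB b (flat.symm (r • x.1))) + (r • x.2.2) • √2 • K) 0
          (F (r • x.2.1)) = _
        rw [RingHom.id_apply, smul_block, block_inj]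
        simp only [map_smul, smul_zero, smul_eq_mul, true_and, and_true]
        module }
  have hT : ∀ x : Heis b, T x = block (A x.2.1)
      (ρ₁₂ x.2.1 + √2 • vec S₀ (opB b (flat.symm x.1)) + x.2.2 • √2 • K) 0 (F x.2.1) :=
    fun _ => rfl
  have hTp : T (Heis.p b) = √2 • block 0 K 0 0 := by
    rw [hT, smul_block, block_inj]
    simp [Heis.p]
  have hTE : ∀ v, T (Heis.ofE b v) = block (A v) (ρ₁₂ v) 0 (F v) := fun v => by
    rw [hT, block_inj]
    simp [Heis.ofE_apply]
  have hTD : ∀ v, T (Heis.ofDual b (flat v)) = block 0 (√2 • vec S₀ (opB b v)) 0 0 := fun v => by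
    rw [hT, block_inj]
    simp [Heis.ofDual_apply]
  let ρ : Heis b →ₗ⁅ℝ⁆ Module.End ℝ (S₀ × S₀) :=
    { T with
      map_lie' := fun {x y} => by
        change T ⁅x, y⁆ = ⁅T x, T y⁆
        rw [Heis.bracket_def, map_smul, hTp, hT x, hT y, Ring.lie_def, block_mul, block_mul,
          block_sub, smul_block, smul_block, block_inj]
        obtain ⟨u, hu⟩ : ∃ u, u = flat.symm x.1 := ⟨_, rfl⟩
        obtain ⟨v, hv⟩ : ∃ v, v = flat.symm y.1 := ⟨_, rfl⟩
        rw [← hu, ← hv, ← inner_opB, ← inner_opB]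
        have h1 := hint (opB b u) y.2.1
        have h2 := hint (opB b v) x.2.1
        have h3 := hsuit x.2.1 y.2.1
        have h4 := hAK x.2.1
        have h5 := hAK y.2.1
        simp only [mul_zero, zero_mul, add_zero, smul_zero, zero_add, sub_self,
          hAA x.2.1 y.2.1, hFF x.2.1 y.2.1, true_and, and_true]
        simp only [mul_add, add_mul, mul_smul_comm, smul_mul_assoc, h4, h5]
        have h6 : A x.2.1 * ρ₁₂ y.2.1 =
            A y.2.1 * ρ₁₂ x.2.1 - ρ₁₂ x.2.1 * F y.2.1 + ρ₁₂ y.2.1 * F x.2.1 := by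
          rw [← h3, sub_add_cancel]
        rw [sub_smul, smul_comm _ √2 K, smul_comm _ √2 K, ← h1, ← h2, h6]
        module }
  refine ⟨ρ, ⟨fun v => ?_, ?_, hTp, hTE⟩, ?_⟩
  · rw [spinRep_wedgeM]; exact hTD v
  · change T (Heis.p b) ≠ 0
    rw [hTp, smul_block, ← block_zero, Ne, block_inj]
    rintro ⟨-, h, -⟩
    exact hK0 ((smul_eq_zero_iff_right hsqrt).1 h)
  · rintro ρ' ⟨hspin, -, hp', hE'⟩
    refine LieHom.ext fun x => ?_
    rw [Heis.eq_add_add b x]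
    change _ = T _
    simp only [map_add, map_smul, hp', hE', hspin (flat.symm x.1), spinRep_wedgeM, hTp, hTE, hTD]

end Representations

end CahenWallach

open CahenWallach in
theorem theorem2p16 {E S₀ : Type*}
    [NormedAddCommGroup E] [InnerProductSpace ℝ E] [FiniteDimensional ℝ E]
    [AddCommGroup S₀] [Module ℝ S₀] [Module (ClE E) S₀] [IsScalarTower ℝ (ClE E) S₀]
    [IsSimpleModule (ClE E) S₀]
    (n : ℕ) (hn : 2 ≤ n) (hmod : n - 1 ≡ 0 [MOD 8])
    (basis : OrthonormalBasis (Fin (n - 1)) ℝ E)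
    (b : LinearMap.BilinForm ℝ E) (hsymm : b.IsSymm) (hnd : b.Nondegenerate) :
    -- the volume element acts as a para-complex structure in the Schur algebra
    (cliff S₀ (volumeElement basis) ∈ schurAlgebra E S₀ ∧
      IsParaComplex (cliff S₀ (volumeElement basis))) ∧
    ∀ 𝓔 ∈ schurAlgebra E S₀, IsParaComplex 𝓔 →
      -- every spin representation of non-zero charge is given by the formula
      (∀ ρ : Heis b →ₗ⁅ℝ⁆ Module.End ℝ (S₀ × S₀), IsSpin ρ → ρ (Heis.p b) ≠ 0 →
        ∃ (s h₁ : ℝ) (h₃ : Module.Dual ℝ E) (ρ₁₂ : E →ₗ[ℝ] Module.End ℝ S₀),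
          (s = 1 ∨ s = -1) ∧ h₁ ≠ 0 ∧
          IsSuitable (diagBlock 𝓔 (-h₁) (s * h₁) h₃) (diagBlock 𝓔 h₁ (s * h₁) h₃) ρ₁₂ ∧
          ρ (Heis.p b) = √2 • block 0 (h₁ • (1 + s • 𝓔)) 0 0 ∧
          ∀ e : E, ρ (Heis.ofE b e) =
            block (diagBlock 𝓔 (-h₁) (s * h₁) h₃ e) (ρ₁₂ e)
              0 (diagBlock 𝓔 h₁ (s * h₁) h₃ e)) ∧
      -- and the formula always defines a spin representation of non-zero charge
      (∀ (s h₁ : ℝ) (h₃ : Module.Dual ℝ E) (ρ₁₂ : E →ₗ[ℝ] Module.End ℝ S₀),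
          (s = 1 ∨ s = -1) → h₁ ≠ 0 →
          IsSuitable (diagBlock 𝓔 (-h₁) (s * h₁) h₃) (diagBlock 𝓔 h₁ (s * h₁) h₃) ρ₁₂ →
        ∃! ρ : Heis b →ₗ⁅ℝ⁆ Module.End ℝ (S₀ × S₀),
          IsSpin ρ ∧ ρ (Heis.p b) ≠ 0 ∧
          ρ (Heis.p b) = √2 • block 0 (h₁ • (1 + s • 𝓔)) 0 0 ∧
          ∀ e : E, ρ (Heis.ofE b e) =
            block (diagBlock 𝓔 (-h₁) (s * h₁) h₃ e) (ρ₁₂ e)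
              0 (diagBlock 𝓔 h₁ (s * h₁) h₃ e)) := by
  have hm : 8 ∣ n - 1 := (Nat.modEq_zero_iff_dvd).1 hmod
  have hm0 : n - 1 ≠ 0 := by omega
  have hm2 : Even (n - 1) := even_iff_two_dvd.2 (.trans (by norm_num) hm)
  have : Nontrivial S₀ := IsSimpleModule.nontrivial (ClE E) S₀
  have hω := vec_basis_mul_cliff_volumeElement S₀ hm2 basis
  refine ⟨⟨mem_schurAlgebra_of_anticommute (vec_anticommute_of_basis basis hω),
    isParaComplex_of_anticommute (cliff_volumeElement_mul_self S₀ hm basis)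
      (vec_basis_mul_self S₀ basis ⟨0, Nat.pos_of_ne_zero hm0⟩) (hω _)⟩, fun 𝓔 h𝓔 hpara => ?_⟩
  have hanti := hpara.anticommute_of_mem_schurAlgebra hm hm0 basis h𝓔
  refine ⟨fun ρ hρ hp => hρ.exists_eq_block hm hm0 basis hnd hpara.1 hanti hp,
    fun s h₁ h₃ ρ₁₂ hs hh₁ hsuit => existsUnique_isSpin hpara.1 hanti ?_ ?_ hs hh₁ hsuit⟩
  · rintro rfl
    exact not_isParaComplex_smul_one (V := S₀) 1 (by rwa [one_smul])
  · rintro rfl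
    exact not_isParaComplex_smul_one (V := S₀) (-1) (by rwa [neg_smul, one_smul])
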